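/- **Setting.** For integers $1\le k<d<N$ let $\phi$ be a probability measure on $\mathbb R^d$ that is even ($\phi(A)=\phi(-A)$) and assigns measure zero to every hyperplane through the origin. Let $X_1,\dots,X_N$ be stochastically independent random vectors with distribution $\phi$. The Donoho–Tanner random cone is $D_N:=\operatorname{pos}\{X_1,\dots,X_N\}$ (positive hull), and $f_k(D_N)$ denotes its number of $k$-dimensional faces; $\mathbb E$ denotes expectation. Let $\mathsf H(x)=-x\log x-(1-x)\log(1-x)$ for $0\le x\le 1$ (with $0\log 0=0$) be the binary entropy function, and $$G(\delta,\rho):=\mathsf H(\delta)+\delta\,\mathsf H(\rho)-(1-\rho\delta)\log 2\qquad(\rho,\delta\in[0,1]).$$ For $1/2<\delta<1$ let $\rho_W(\delta):=2-1/\delta$, and let $\rho_S(\delta)$ be the unique zero of $G(\delta,\cdot)$ in $[0,1]$. **Theorem.** Let $1/2<\delta<1$ and $0<\rho<\rho_W(\delta)$. (a) Let $N=N(d)$ and $k=k(d)$ be integers with $1\le k<d<N$, given for all $d\ge d_0$, such that $$\delta_d:=\frac dN\to\delta,\qquad \rho_d:=\frac kd\to\rho\qquad\text{as }d\to\infty,$$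 and for each $d\ge d_0$ let $D_N$ be a Donoho–Tanner cone in $\mathbb R^d$ as above (the distribution $\phi=\phi_d$ may depend on $d$). Then $f_k(D_N)$ is integrable, and $$\binom Nk-\mathbb E f_k(D_N)=\frac1N\,e^{N G(\delta_d,\rho_d)}\cdot g(d)\qquad (d\ge d_0),$$ where, for some constants $0<a\le b<\infty$ not depending on $d$, $g(d)\in[a,b]$ for all $d\ge d_0$. In particular, $$\lim_{d\to\infty}\left[\binom Nk-\mathbb E f_k(D_N)\right]=\begin{cases}0&\text{if }\rho<\rho_S(\delta),\\ \infty&\text{if }\rho>\rho_S(\delta).\end{cases}$$ (b) If $\rho=\rho_S(\delta)$, then integers $N=N(d)$ and $k=k(d)$ with $1\le k<d<N$ $(d\ge2)$ and $d/N\to\delta$, $k/d\to\rho$ can be chosen such that, for all distributions $\phi_d$ as above, $$\liminf_{d\to\infty}\left[\binom Nk-\mathbb E f_k(D_N)\right]=0\quad\text{and}\quad\limsup_{d\to\infty}\left[\binom Nk-\mathbb E f_k(D_N)\right]=\infty.$$ -/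

import Mathlib

open MeasureTheory ProbabilityTheory Filter Topology

noncomputable section

namespace DonohoTanner

/-- The standard Euclidean space of dimension `d`. -/
abbrev E (d : ℕ) : Type := EuclideanSpace ℝ (Fin d)

/-- `f_k(C)`: the number of `k`-dimensional faces of a polyhedral convex cone `C` in `ℝ^d`.
Every face contains the origin, so its dimension is the dimension of its linear span. -/
def numFaces {d : ℕ} (k : ℕ) (C : PointedCone ℝ (E d)) : ℕ :=
  Set.ncard {F : PointedCone ℝ (E d) |
    F.IsFaceOf C ∧ Module.finrank ℝ (Submodule.span ℝ (F : Set (E d))) = k}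

/-- `pos {x_1, …, x_N}`: the positive hull of finitely many vectors. -/
def pos {d N : ℕ} (x : Fin N → E d) : PointedCone ℝ (E d) :=
  PointedCone.hull ℝ (Set.range x)

/-- A probability measure on `ℝ^d` that is even and assigns measure zero to every hyperplane
through the origin. -/
structure IsAdmissible {d : ℕ} (φ : Measure (E d)) : Prop where
  prob : IsProbabilityMeasure φ
  even : Measure.map (fun x => -x) φ = φ
  hyperplane : ∀ v : E d, v ≠ 0 → φ {x | inner ℝ v x = 0} = 0

/-- `X_1, …, X_N` are stochastically independent random vectors in `ℝ^d` with common
distribution `φ`, where `φ` is even and does not charge hyperplanes through the origin.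
The Donoho–Tanner cone is then `D_N = pos {X_1, …, X_N}`. -/
structure IsSample {d N : ℕ} {Ω : Type*} [MeasurableSpace Ω] (P : Measure Ω)
    (φ : Measure (E d)) (X : Fin N → Ω → E d) : Prop where
  admissible : IsAdmissible φ
  hasLaw : ∀ i, HasLaw (X i) φ P
  indep : iIndepFun X P

/-- `f_k(D_N)` as a random variable. -/
def faceCount {d N : ℕ} {Ω : Type*} (k : ℕ) (X : Fin N → Ω → E d) (ω : Ω) : ℝ :=
  (numFaces k (pos fun i => X i ω) : ℝ)

/-- The difference `binom(N, k) - 𝔼 f_k(D_N)`. -/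
def faceDefect {d N : ℕ} {Ω : Type*} [MeasurableSpace Ω] (P : Measure Ω) (k : ℕ)
    (X : Fin N → Ω → E d) : ℝ :=
  (N.choose k : ℝ) - ∫ ω, faceCount k X ω ∂P

/-- `G(δ, ρ) = H(δ) + δ H(ρ) - (1 - ρ δ) log 2`, with `H` the binary entropy to base `e`. -/
def G (δ ρ : ℝ) : ℝ :=
  Real.binEntropy δ + δ * Real.binEntropy ρ - (1 - ρ * δ) * Real.log 2

/-- `ρ_W(δ) = max {0, 2 - 1/δ}`. -/
def rhoW (δ : ℝ) : ℝ := max 0 (2 - δ⁻¹)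

/-- For `1/2 < δ < 1` the function `G(δ, ·)` has exactly one zero in `[0, 1]`. -/
theorem existsUnique_zero {δ : ℝ} (h1 : 1 / 2 < δ) (h2 : δ < 1) :
    ∃! x : ℝ, x ∈ Set.Icc (0 : ℝ) 1 ∧ G δ x = 0 := by
  have hlog : 0 < Real.log 2 := Real.log_pos (by norm_num)
  have h0 : G δ 0 < 0 := by
    have : Real.binEntropy δ < Real.log 2 :=
      Real.binEntropy_lt_log_two.2 (by intro h; rw [h] at h1; norm_num at h1)
    simp only [G, Real.binEntropy_zero]
    linarith
  have hH : (1 - δ) * Real.log 2 < Real.binEntropy δ := by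
    have := Real.strictConcave_binEntropy.concaveOn.2
      (by norm_num : (1 : ℝ) ∈ Set.Icc (0 : ℝ) 1) (by norm_num : (2⁻¹ : ℝ) ∈ Set.Icc (0 : ℝ) 1)
      (by linarith : (0 : ℝ) ≤ 2 * δ - 1) (by linarith : (0 : ℝ) ≤ 2 - 2 * δ) (by ring)
    simp only [smul_eq_mul, Real.binEntropy_one, Real.binEntropy_two_inv] at this
    have e : (2 * δ - 1) * 1 + (2 - 2 * δ) * 2⁻¹ = δ := by ring
    rw [e] at this
    nlinarith
  have hone : 0 < G δ 1 := by
    simp only [G, Real.binEntropy_one]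
    linarith
  have hcont : Continuous (G δ) := by
    unfold G
    fun_prop
  have key : ∀ x y : ℝ, 0 ≤ x → x < y → y ≤ 1 → G δ x = 0 → G δ y ≠ 0 := by
    intro x y hx hxy hy gx gy
    rcases eq_or_lt_of_le hy with rfl | hy
    · linarith
    have hd : 0 < 1 - x := by linarith
    have ha : 0 < (1 - y) / (1 - x) := div_pos (by linarith) hd
    have hb : 0 < (y - x) / (1 - x) := div_pos (by linarith) hd
    have := Real.strictConcave_binEntropy.2
      (⟨hx, by linarith⟩ : x ∈ Set.Icc (0 : ℝ) 1) (by norm_num : (1 : ℝ) ∈ Set.Icc (0 : ℝ) 1)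
      (by linarith : x < 1).ne ha hb (by field_simp; ring)
    simp only [smul_eq_mul, Real.binEntropy_one] at this
    have e : (1 - y) / (1 - x) * x + (y - x) / (1 - x) * 1 = y := by field_simp; ring
    rw [e] at this
    have h3 : (1 - y) * Real.binEntropy x < (1 - x) * Real.binEntropy y := by
      have := mul_lt_mul_of_pos_left this hd
      have e2 : (1 - x) * ((1 - y) / (1 - x) * Real.binEntropy x + (y - x) / (1 - x) * 0)
          = (1 - y) * Real.binEntropy x := by field_simp; ring
      linarith
    have h4 := mul_lt_mul_of_pos_left h3 (by linarith : 0 < δ)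
    have h5 : 0 < (y - x) * G δ 1 := mul_pos (by linarith) hone
    simp only [G, Real.binEntropy_one] at gx gy h5
    have gx' : (1 - y) * (Real.binEntropy δ + δ * Real.binEntropy x
      - (1 - x * δ) * Real.log 2) = 0 := by rw [gx, mul_zero]
    have gy' : (1 - x) * (Real.binEntropy δ + δ * Real.binEntropy y
      - (1 - y * δ) * Real.log 2) = 0 := by rw [gy, mul_zero]
    linarith
  obtain ⟨x, hx, hGx⟩ := intermediate_value_Icc (zero_le_one (α := ℝ)) hcont.continuousOn
    (show (0 : ℝ) ∈ Set.Icc (G δ 0) (G δ 1) from ⟨h0.le, hone.le⟩)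
  refine ⟨x, ⟨hx, hGx⟩, ?_⟩
  rintro y ⟨hy, hGy⟩
  rcases lt_trichotomy x y with h | h | h
  · exact absurd hGy (key x y hx.1 h hy.2 hGx)
  · exact h.symm
  · exact absurd hGx (key y x hy.1 h hx.2 hGy)

/-- `ρ_S(δ)`: the zero of `G(δ, ·)` in `[0, 1]`, which is unique for `1/2 < δ < 1`. -/
def rhoS (δ : ℝ) : ℝ := sInf {x : ℝ | x ∈ Set.Icc (0 : ℝ) 1 ∧ G δ x = 0}

/-- For `1/2 < δ < 1`, `ρ_S(δ)` is the unique zero of `G(δ, ·)` in `[0, 1]`. -/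
theorem eq_rhoS_iff {δ : ℝ} (h1 : 1 / 2 < δ) (h2 : δ < 1) (x : ℝ) :
    x = rhoS δ ↔ x ∈ Set.Icc (0 : ℝ) 1 ∧ G δ x = 0 := by
  obtain ⟨z, hz, hu⟩ := existsUnique_zero h1 h2
  have hset : {x : ℝ | x ∈ Set.Icc (0 : ℝ) 1 ∧ G δ x = 0} = {z} :=
    Set.eq_singleton_iff_unique_mem.2 ⟨hz, hu⟩
  have hr : rhoS δ = z := by rw [rhoS, hset, csInf_singleton]
  rw [hr]
  exact ⟨fun h => h ▸ hz, fun h => hu x h⟩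

/-- The integers `N = N(d)` and `k = k(d)`, given for all dimensions `d ≥ d₀`, satisfy
`1 ≤ k < d < N` and grow such that `d / N → δ` and `k / d → ρ` as `d → ∞`. -/
structure IsGrowth (δ ρ : ℝ) (d₀ : ℕ) (N k : ℕ → ℕ) : Prop where
  one_le : ∀ d ≥ d₀, 1 ≤ k d
  lt_dim : ∀ d ≥ d₀, k d < d
  dim_lt : ∀ d ≥ d₀, d < N d
  tendsto_delta : Tendsto (fun d : ℕ => (d : ℝ) / (N d : ℝ)) atTop (𝓝 δ)
  tendsto_rho : Tendsto (fun d : ℕ => (k d : ℝ) / (d : ℝ)) atTop (𝓝 ρ)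

end DonohoTanner

end

/-! The vectors are almost surely in general position, since `φ` does not charge hyperplanes. For
`|I| = k < d`, the cone over `x_I` is then a face exactly when the other `N - k` vectors have no
nontrivial nonnegative relation modulo the span of `x_I`, and every `k`-face arises from exactly one
such `I` (`numFaces_pos_eq`). In this quotient of dimension `d - k`, the number of sign choices that
leave no relation depends only on `N - k` and `d - k` (Schläfli, Wendel: `sum_acyclic_signFlip`).
Evenness of `φ` allows averaging over signs, so this number divided by `2 ^ (N - k)` is the
probability that `I` gives a face (`IsAdmissible.measureReal_acyclic`).

By Pascal's rule the defect is therefore `binom(N, k)` times the probability that a fair binomial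
variable with `N - k - 1` trials is at least `d - k`. The condition `ρ < ρ_W(δ)` says that, in the
limit, `(N - d) / (d - k) < 1`; beyond `d - k` the binomial coefficients then decay geometrically,
and the tail is comparable to its first term (`sum_Ico_choose_le`). Up to a bounded factor this
leaves a trinomial coefficient divided by `2 ^ (N - k)`, for which Stirling's formula gives the
order `exp(N G) / N` (`normalizedDefect_eq`).

The limits follow from the sign of `G(δ, ρ)`. As `G(δ, ·)` is concave and positive at `1`, it
crosses its zero `ρ_S` with at least a fixed positive slope. At `ρ = ρ_S`, moving `k / d` by `± 1 /
√d` therefore makes `N G` nonpositive or at least of order `√d`, whereas rounding `N` changes `N G`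
only by a bounded amount. Alternating the sign with the parity of `d` yields both limit points. -/

noncomputable section

namespace DonohoTanner

/-! ### Counting sign choices without positive relations (Schläfli, Wendel) -/

section SignCount

/-- The vectors `x i` with the signs of those with `i ∈ S` changed. -/
def signFlip {ι V : Type*} [DecidableEq ι] [Neg V] (S : Finset ι) (x : ι → V) (i : ι) : V :=
  if i ∈ S then -x i else x i

theorem signFlip_of_notMem {ι V : Type*} [DecidableEq ι] [Neg V] {S : Finset ι} {x : ι → V}
    {i : ι} (h : i ∉ S) : signFlip S x i = x i := by
  simp [signFlip, h]

variable {ι V : Type*} [AddCommGroup V] [Module ℝ V]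

/-- Modulo the subspace `U`, the vectors `x i`, `i ∈ J`, satisfy no nontrivial linear relation
with nonnegative coefficients. -/
def Acyclic (U : Submodule ℝ V) (x : ι → V) (J : Finset ι) : Prop :=
  ∀ c : ι → ℝ, (∀ i ∈ J, 0 ≤ c i) → ∑ i ∈ J, c i • x i ∈ U → ∀ i ∈ J, c i = 0

/-- Any at most `d` of the vectors `x i` are linearly independent. -/
def GenPos (d : ℕ) (x : ι → V) : Prop :=
  ∀ T : Finset ι, T.card ≤ d → LinearIndepOn ℝ x (T : Set ι)

theorem Acyclic.congr {U : Submodule ℝ V} {x y : ι → V} {J : Finset ι}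
    (h : ∀ i ∈ J, x i = y i) : Acyclic U x J ↔ Acyclic U y J := by
  refine forall_congr' fun c => ?_
  rw [Finset.sum_congr rfl fun i hi => by rw [h i hi]]

theorem span_image_ne_top {d : ℕ} [FiniteDimensional ℝ V] (hd : Module.finrank ℝ V = d) {x : ι → V}
    {K : Finset ι} (hK : K.card < d) : Submodule.span ℝ (x '' (K : Set ι)) ≠ ⊤ := by
  classical
  intro h
  have h1 := finrank_span_finset_le_card (R := ℝ) (K.image x)
  rw [Finset.coe_image, Set.finrank, h, finrank_top, hd] at h1
  have := Finset.card_image_le (s := K) (f := x)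
  omega

theorem GenPos.finrank_span {d : ℕ} {x : ι → V} (hx : GenPos d x) {K : Finset ι}
    (hK : K.card ≤ d) : Module.finrank ℝ (Submodule.span ℝ (x '' (K : Set ι))) = K.card := by
  have h := hx K hK
  have := finrank_span_eq_card (R := ℝ) h
  rw [← Set.image_eq_range] at this
  simpa using this

variable [DecidableEq ι]

theorem acyclic_insert_iff {U : Submodule ℝ V} {x : ι → V} {J : Finset ι} {j : ι} (hj : j ∉ J) :
    Acyclic U x (insert j J) ↔ ∀ (c : ι → ℝ) (t : ℝ), (∀ i ∈ J, 0 ≤ c i) → 0 ≤ t →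
      t • x j + ∑ i ∈ J, c i • x i ∈ U → t = 0 ∧ ∀ i ∈ J, c i = 0 := by
  constructor
  · intro h c t hc ht hU
    have hne : ∀ i ∈ J, i ≠ j := fun i hi e => hj (e ▸ hi)
    have key := h (Function.update c j t) ?_ ?_
    · refine ⟨by simpa using key j (by simp), fun i hi => ?_⟩
      simpa [hne i hi] using key i (by simp [hi])
    · intro i hi
      rcases Finset.mem_insert.1 hi with rfl | hi
      · simpa using ht
      · simpa [hne i hi] using hc i hi
    · rw [Finset.sum_insert hj]
      have : ∑ i ∈ J, Function.update c j t i • x i = ∑ i ∈ J, c i • x i :=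
        Finset.sum_congr rfl fun i hi => by simp [hne i hi]
      simpa [this] using hU
  · intro h c hc hU i hi
    rw [Finset.sum_insert hj] at hU
    obtain ⟨h1, h2⟩ := h c (c j) (fun i hi => hc i (by simp [hi])) (hc j (by simp)) hU
    rcases Finset.mem_insert.1 hi with rfl | hi
    · exact h1
    · exact h2 i hi

theorem Acyclic.subset {U : Submodule ℝ V} {x : ι → V} {J : Finset ι} {j : ι} (hj : j ∉ J)
    (h : Acyclic U x (insert j J)) : Acyclic U x J := by
  intro c hc hU
  exact ((acyclic_insert_iff hj).1 h c 0 hc le_rfl (by simpa using hU)).2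

/-- If both signs at `j` admitted a relation, both would use `j` with positive coefficient.
Combining them with crossed weights cancels `x j` and leaves a relation on `J`; so all coefficients
on `J` vanish, which forces `x j ∈ U`. -/
theorem acyclic_insert_or {U : Submodule ℝ V} {x y : ι → V} {J : Finset ι} {j : ι} (hj : j ∉ J)
    (hxy : ∀ i ∈ J, y i = x i) (hyj : y j = -x j) (hxU : x j ∉ U) (h : Acyclic U x J) :
    Acyclic U x (insert j J) ∨ Acyclic U y (insert j J) := by
  by_contra hcon
  rw [not_or, acyclic_insert_iff hj, acyclic_insert_iff hj] at hcon
  push Not at hcon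
  obtain ⟨⟨c, t, hc, ht, hU, h1⟩, ⟨c', t', hc', ht', hU', h1'⟩⟩ := hcon
  rw [Finset.sum_congr rfl fun i hi => by rw [hxy i hi], hyj] at hU'
  have ht0 : 0 < t := by
    refine lt_of_le_of_ne ht fun e => ?_
    obtain ⟨i, hi, hne⟩ := h1 e.symm
    exact hne (h c hc (by simpa [← e] using hU) i hi)
  have ht0' : 0 < t' := by
    refine lt_of_le_of_ne ht' fun e => ?_
    obtain ⟨i, hi, hne⟩ := h1' e.symm
    exact hne (h c' hc' (by simpa [← e] using hU') i hi)
  have hsum : ∑ i ∈ J, (t' * c i + t * c' i) • x i ∈ U := by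
    have := U.add_mem (U.smul_mem t' hU) (U.smul_mem t hU')
    convert this using 1
    simp only [add_smul, mul_smul, Finset.sum_add_distrib, ← Finset.smul_sum, smul_add, smul_neg]
    rw [smul_comm t' t]
    abel
  have hz := h _ (fun i hi => add_nonneg (mul_nonneg ht' (hc i hi)) (mul_nonneg ht (hc' i hi))) hsum
  have hcz : ∀ i ∈ J, c i = 0 := by
    intro i hi
    have h2 := hz i hi
    have h3 := mul_nonneg ht' (hc i hi)
    have h4 := mul_nonneg ht (hc' i hi)
    have : t' * c i = 0 := by linarith
    exact (mul_eq_zero.1 this).resolve_left ht0'.ne'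
  rw [Finset.sum_eq_zero fun i hi => by rw [hcz i hi, zero_smul], add_zero] at hU
  exact hxU ((U.smul_mem_iff ht0.ne').1 hU)

/-- Nonnegative multiples of `x j` and of `-x j` together give all real multiples, so testing both
signs amounts to working modulo `x j`. A relation involving `x j` alone is excluded by `hxU`. -/
theorem acyclic_insert_and_iff {U : Submodule ℝ V} {x y : ι → V} {J : Finset ι} {j : ι}
    (hj : j ∉ J) (hxy : ∀ i ∈ J, y i = x i) (hyj : y j = -x j) (hxU : x j ∉ U) :
    Acyclic U x (insert j J) ∧ Acyclic U y (insert j J) ↔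
      Acyclic (U ⊔ Submodule.span ℝ {x j}) x J := by
  rw [acyclic_insert_iff hj, acyclic_insert_iff hj]
  constructor
  · rintro ⟨h1, h2⟩ c hc hU
    obtain ⟨u, hu, w, hw, huw⟩ := Submodule.mem_sup.1 hU
    obtain ⟨s, rfl⟩ := Submodule.mem_span_singleton.1 hw
    rcases le_total s 0 with hs | hs
    · refine (h1 c (-s) hc (by linarith) ?_).2
      rw [← huw]
      simpa using hu
    · refine (h2 c s hc hs ?_).2
      rw [Finset.sum_congr rfl fun i hi => by rw [hxy i hi], ← huw, hyj]
      simpa using hu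
  · intro h
    have hx : ∀ s : ℝ, s • x j ∈ Submodule.span ℝ {x j} := fun s =>
      Submodule.smul_mem _ _ (Submodule.mem_span_singleton_self _)
    have aux : ∀ (c : ι → ℝ) (s : ℝ), (∀ i ∈ J, 0 ≤ c i) → s • x j + ∑ i ∈ J, c i • x i ∈ U →
        s = 0 ∧ ∀ i ∈ J, c i = 0 := by
      intro c s hc hU
      have hz := h c hc (by
        have := Submodule.add_mem_sup hU (hx (-s))
        simpa using this)
      refine ⟨?_, hz⟩
      rw [Finset.sum_eq_zero fun i hi => by rw [hz i hi, zero_smul], add_zero] at hU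
      by_contra hs
      exact hxU ((U.smul_mem_iff hs).1 hU)
    refine ⟨fun c t hc _ hU => aux c t hc hU, fun c t hc _ hU => ?_⟩
    rw [Finset.sum_congr rfl fun i hi => by rw [hxy i hi], hyj] at hU
    have := aux c (-t) hc (by simpa using hU)
    exact ⟨by linarith [this.1], this.2⟩

/-- The number of sign choices in Schläfli's and Wendel's theorem, for `m` vectors in general
position in dimension `n`. -/
def signCount : ℕ → ℕ → ℕ
  | 0, _ => 1
  | _ + 1, 0 => 0
  | m + 1, n + 1 => signCount m (n + 1) + signCount m n

theorem GenPos.notMem_span {d : ℕ} {x : ι → V} (hx : GenPos d x) {K : Finset ι}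
    (hK : K.card < d) {j : ι} (hj : j ∉ K) : x j ∉ Submodule.span ℝ (x '' (K : Set ι)) := by
  have h := hx (insert j K) (by rw [Finset.card_insert_of_notMem hj]; omega)
  rw [Finset.coe_insert, linearIndepOn_insert (by simpa using hj)] at h
  exact h.2

/-- Deletion and contraction. Among the two signs of `x j`, the number of good ones is the indicator
of "at least one" plus that of "both": the first is acyclicity of `J` modulo `U`, the second
acyclicity modulo `U` and `x j`. The second case enlarges `K`, hence the induction over all `K`. -/
theorem sum_acyclic_signFlip {d : ℕ} [FiniteDimensional ℝ V] (hd : Module.finrank ℝ V = d) {x : ι → V}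
    (hx : GenPos d x) (J : Finset ι) :
    ∀ K : Finset ι, Disjoint J K → K.card ≤ d →
      (∑ S ∈ J.powerset, open Classical in
        if Acyclic (Submodule.span ℝ (x '' (K : Set ι))) (signFlip S x) J then 1 else 0) =
        signCount J.card (d - K.card) := by
  classical
  induction J using Finset.induction_on with
  | empty => intro K _ _; simp [Acyclic, signCount]
  | insert j J hj ih =>
    intro K hJK hK
    have hjK : j ∉ K := fun h => Finset.disjoint_left.1 hJK (by simp) h
    have hJK' : Disjoint J K := hJK.mono_left (by simp)
    rw [Finset.card_insert_of_notMem hj]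
    rcases hK.eq_or_lt with hK | hK
    · have htop : Submodule.span ℝ (x '' (K : Set ι)) = ⊤ := by
        apply Submodule.eq_top_of_finrank_eq
        rw [hx.finrank_span hK.le, hd, hK]
      rw [hK, Nat.sub_self, signCount]
      refine Finset.sum_eq_zero fun S _ => if_neg fun h => ?_
      have := h (fun _ => 1) (by simp) (by simp [htop]) j (by simp)
      norm_num at this
    · obtain ⟨n, hn⟩ : ∃ n, d - K.card = n + 1 := ⟨d - K.card - 1, by omega⟩
      rw [Finset.sum_powerset_insert hj, ← Finset.sum_add_distrib, hn, signCount, ← hn,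
        ← ih K hJK' hK.le]
      have hn' : n = d - (insert j K).card := by rw [Finset.card_insert_of_notMem hjK]; omega
      rw [hn', ← ih (insert j K) (by simp [hJK', hj]) (by
        rw [Finset.card_insert_of_notMem hjK]; omega), ← Finset.sum_add_distrib]
      refine Finset.sum_congr rfl fun S hS => ?_
      have hS := Finset.mem_powerset.1 hS
      have hjS : j ∉ S := fun h => hj (hS h)
      set U := Submodule.span ℝ (x '' (K : Set ι)) with hU
      have e1 : ∀ i ∈ J, signFlip (insert j S) x i = signFlip S x i := by
        intro i hi
        have : i ≠ j := fun e => hj (e ▸ hi)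
        simp [signFlip, this]
      have e2 : signFlip (insert j S) x j = -signFlip S x j := by simp [signFlip, hjS]
      have e3 : signFlip S x j ∉ U := by
        rw [signFlip_of_notMem hjS]; exact hx.notMem_span hK hjK
      have e4 : Submodule.span ℝ (x '' ((insert j K : Finset ι) : Set ι)) =
          U ⊔ Submodule.span ℝ {signFlip S x j} := by
        rw [signFlip_of_notMem hjS, Finset.coe_insert, Set.image_insert_eq, Submodule.span_insert,
          sup_comm]
      have hand := acyclic_insert_and_iff hj e1 e2 e3
      rw [← e4] at hand
      have hor : Acyclic U (signFlip S x) J ↔ Acyclic U (signFlip S x) (insert j J) ∨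
          Acyclic U (signFlip (insert j S) x) (insert j J) :=
        ⟨acyclic_insert_or hj e1 e2 e3, fun h => h.elim (Acyclic.subset hj) fun h =>
          (Acyclic.congr e1).1 (Acyclic.subset hj h)⟩
      rw [← hand]
      simp only [hor]
      by_cases h1 : Acyclic U (signFlip S x) (insert j J) <;>
        by_cases h2 : Acyclic U (signFlip (insert j S) x) (insert j J) <;> simp [h1, h2]

end SignCount

/-! ### Faces of a cone whose generators are in general position -/

section Faces

variable {ι V : Type*} [AddCommGroup V] [Module ℝ V]

theorem mem_hull_image_finset_iff {x : ι → V} {I : Finset ι} {y : V} :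
    y ∈ PointedCone.hull ℝ (x '' (I : Set ι)) ↔
      ∃ c : ι → ℝ, (∀ i ∈ I, 0 ≤ c i) ∧ ∑ i ∈ I, c i • x i = y := by
  rw [PointedCone.hull, Submodule.mem_span_image_finset_iff_exists_fun']
  constructor
  · rintro ⟨c, hc⟩
    exact ⟨fun i => c i, fun i _ => (c i).2, hc⟩
  · rintro ⟨c, hc, h⟩
    refine ⟨fun i => ⟨max (c i) 0, le_max_right _ _⟩, ?_⟩
    rw [← h]
    refine Finset.sum_congr rfl fun i hi => ?_
    change (max (c i) 0) • x i = c i • x i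
    rw [max_eq_left (hc i hi)]

theorem GenPos.card_of_finrank_span {d k : ℕ} {x : ι → V} (hx : GenPos d x) (hk : k < d)
    {I : Finset ι} (hI : Module.finrank ℝ (Submodule.span ℝ (x '' (I : Set ι))) = k) :
    I.card = k := by
  rcases le_or_gt I.card d with h | h
  · rw [← hI, hx.finrank_span h]
  · obtain ⟨T, hT, hTc⟩ := Finset.exists_subset_card_eq h.le
    have h1 := hx.finrank_span hTc.le
    have : FiniteDimensional ℝ (Submodule.span ℝ (x '' (I : Set ι))) :=
      FiniteDimensional.span_of_finite ℝ (I.finite_toSet.image x)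
    have h2 := Submodule.finrank_mono (R := ℝ)
      (Submodule.span_mono (Set.image_mono (f := x) (Finset.coe_subset.2 hT)))
    omega

theorem span_hull (s : Set V) :
    Submodule.span ℝ (PointedCone.hull ℝ s : Set V) = Submodule.span ℝ s := by
  refine le_antisymm (Submodule.span_le.2 fun y hy => ?_)
    (Submodule.span_mono PointedCone.subset_hull)
  exact PointedCone.hull_le_span ℝ s hy

variable [Fintype ι]

theorem mem_hull_range_iff {x : ι → V} {y : V} :
    y ∈ PointedCone.hull ℝ (Set.range x) ↔ ∃ c : ι → ℝ, (∀ i, 0 ≤ c i) ∧ ∑ i, c i • x i = y := by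
  have := mem_hull_image_finset_iff (x := x) (I := Finset.univ) (y := y)
  simpa using this

variable [DecidableEq ι]

/-- If `a • y + z` lies in the subcone, its coefficients outside `I` form a nonnegative relation
modulo the span, hence vanish. As they are sums of nonnegative terms and `a > 0`, those of `y`
vanish too. -/
theorem Acyclic.isFaceOf {x : ι → V} {I : Finset ι}
    (h : Acyclic (Submodule.span ℝ (x '' (I : Set ι))) x Iᶜ) :
    (PointedCone.hull ℝ (x '' (I : Set ι))).IsFaceOf (PointedCone.hull ℝ (Set.range x)) := by
  refine ⟨Submodule.span_mono (Set.image_subset_range _ _), ?_⟩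
  intro y z a hy hz ha hyz
  obtain ⟨b, hb, rfl⟩ := mem_hull_range_iff.1 hy
  obtain ⟨c, hc, rfl⟩ := mem_hull_range_iff.1 hz
  have hsp := PointedCone.hull_le_span ℝ _ hyz
  have hmem : ∀ e : ι → ℝ, ∑ i ∈ I, e i • x i ∈ Submodule.span ℝ (x '' (I : Set ι)) := fun e =>
    Submodule.mem_span_image_finset_iff_exists_fun' ℝ |>.2 ⟨e, rfl⟩
  have hsum : ∑ i ∈ Iᶜ, (a * b i + c i) • x i ∈ Submodule.span ℝ (x '' (I : Set ι)) := by
    have h1 : a • ∑ i, b i • x i + ∑ i, c i • x i = ∑ i, (a * b i + c i) • x i := by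
      simp only [add_smul, mul_smul, Finset.sum_add_distrib, ← Finset.smul_sum]
    have h2 := Finset.sum_add_sum_compl I fun i => (a * b i + c i) • x i
    rw [← eq_sub_iff_add_eq', ← h1] at h2
    rw [h2]
    exact Submodule.sub_mem _ hsp (hmem _)
  have hz := h _ (fun i _ => add_nonneg (mul_nonneg ha.le (hb i)) (hc i)) hsum
  refine mem_hull_image_finset_iff.2 ⟨b, fun i _ => hb i, ?_⟩
  rw [← Finset.sum_add_sum_compl I, left_eq_add]
  refine Finset.sum_eq_zero fun i hi => ?_
  have h1 := hz i hi
  have h2 := mul_nonneg ha.le (hb i)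
  have h3 := hc i
  have h4 : a * b i = 0 := by linarith
  rw [(mul_eq_zero.1 h4).resolve_left ha.ne', zero_smul]

/-- `I` consists of the generators lying in `F`. A relation among the others modulo their span would
yield a point of `F` that uses a generator outside `F` with positive weight, which a face forbids.
-/
theorem exists_acyclic_of_isFaceOf {d k : ℕ} {x : ι → V} (hx : GenPos d x) (hk : k < d)
    {F : PointedCone ℝ V} (hF : F.IsFaceOf (PointedCone.hull ℝ (Set.range x)))
    (hFk : Module.finrank ℝ (Submodule.span ℝ (F : Set V)) = k) :
    ∃ I : Finset ι, I.card = k ∧ Acyclic (Submodule.span ℝ (x '' (I : Set ι))) x Iᶜ ∧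
      PointedCone.hull ℝ (x '' (I : Set ι)) = F := by
  classical
  have hxC : ∀ i, x i ∈ PointedCone.hull ℝ (Set.range x) := fun i =>
    PointedCone.subset_hull ⟨i, rfl⟩
  let I : Finset ι := Finset.univ.filter fun i => x i ∈ F
  have hI : ∀ i, i ∈ I ↔ x i ∈ F := by simp [I]
  have hIF : PointedCone.hull ℝ (x '' (I : Set ι)) = F := by
    refine le_antisymm (Submodule.span_le.2 ?_) ?_
    · rintro _ ⟨i, hi, rfl⟩
      exact (hI i).1 hi
    · intro y hy
      obtain ⟨c, hc, rfl⟩ := mem_hull_range_iff.1 (hF.le hy)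
      refine mem_hull_image_finset_iff.2 ⟨c, fun i _ => hc i, ?_⟩
      refine Finset.sum_subset (Finset.subset_univ I) fun i _ hi => ?_
      rcases (hc i).eq_or_lt with h0 | h0
      · rw [← h0, zero_smul]
      · exact absurd ((hI i).2 (hF.mem_of_sum_smul_mem hxC hc hy i h0)) hi
  refine ⟨I, ?_, ?_, hIF⟩
  · refine hx.card_of_finrank_span hk ?_
    rw [← span_hull, hIF, hFk]
  · intro c hc hU i hi
    by_contra hne
    have hpos : 0 < c i := lt_of_le_of_ne (hc i hi) (Ne.symm hne)
    obtain ⟨a, ha⟩ := (Submodule.mem_span_image_finset_iff_exists_fun' ℝ).1 hU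
    -- Adding the negative parts of `a` to both sides of `∑ a j • x j = ∑ c j • x j` makes all
    -- coefficients nonnegative, so the common value lies in `F`.
    let e : ι → ℝ := fun j => if j ∈ I then max (-a j) 0 else c j
    have he : ∀ j, 0 ≤ e j := by
      intro j
      by_cases hj : j ∈ I
      · simp [e, hj]
      · simpa [e, hj] using hc j (by simpa using hj)
    have hsum : ∑ j, e j • x j ∈ F := by
      rw [← hIF, mem_hull_image_finset_iff]
      refine ⟨fun j => max (a j) 0, fun j _ => le_max_right _ _, ?_⟩
      rw [← Finset.sum_add_sum_compl I]
      have h1 : ∑ j ∈ Iᶜ, e j • x j = ∑ j ∈ Iᶜ, c j • x j :=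
        Finset.sum_congr rfl fun j hj => by simp [e, Finset.mem_compl.1 hj]
      rw [h1, ← ha, ← Finset.sum_add_distrib]
      refine Finset.sum_congr rfl fun j hj => ?_
      rw [← add_smul]
      congr 1
      simp only [e, hj, if_true]
      rcases le_total (a j) 0 with h | h
      · rw [max_eq_right h, max_eq_left (by linarith)]; ring
      · rw [max_eq_left h, max_eq_right (by linarith)]; ring
    have hiI : i ∉ I := Finset.mem_compl.1 hi
    exact hiI ((hI i).2 (hF.mem_of_sum_smul_mem hxC he hsum i (by simpa [e, hiI] using hpos)))

end Faces

/-- Distinct `I` give distinct faces: by general position and `k < d`, no further generator lies in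
the span of `k` of them. -/
theorem numFaces_pos_eq {d N k : ℕ} (hk : k < d) {x : Fin N → E d} (hx : GenPos d x) :
    numFaces k (pos x) = ∑ I ∈ Finset.univ.powersetCard k, open Classical in
      if Acyclic (Submodule.span ℝ (x '' (I : Set (Fin N)))) x Iᶜ then 1 else 0 := by
  classical
  rw [Finset.sum_boole]
  have himg : {F : PointedCone ℝ (E d) | F.IsFaceOf (pos x) ∧
      Module.finrank ℝ (Submodule.span ℝ (F : Set (E d))) = k} =
      (fun I : Finset (Fin N) => PointedCone.hull ℝ (x '' (I : Set (Fin N)))) ''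
        ((Finset.univ.powersetCard k).filter fun I =>
          Acyclic (Submodule.span ℝ (x '' (I : Set (Fin N)))) x Iᶜ : Finset (Finset (Fin N))) := by
    ext F
    simp only [Set.mem_ofPred_eq, Set.mem_image, Finset.coe_filter, Finset.mem_powersetCard,
      Finset.subset_univ, true_and]
    constructor
    · rintro ⟨h1, h2⟩
      obtain ⟨I, hI, hA, hF⟩ := exists_acyclic_of_isFaceOf hx hk h1 h2
      exact ⟨I, ⟨hI, hA⟩, hF⟩
    · rintro ⟨I, ⟨hI, hA⟩, rfl⟩
      refine ⟨hA.isFaceOf, ?_⟩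
      rw [span_hull, hx.finrank_span (by omega), hI]
  rw [numFaces, himg, Set.InjOn.ncard_image, Set.ncard_coe_finset]
  · rfl
  · intro I hI J hJ hIJ
    simp only [Finset.coe_filter, Finset.mem_powersetCard, Finset.subset_univ, true_and,
      Set.mem_ofPred_eq] at hI hJ
    have hsub : ∀ I J : Finset (Fin N), J.card = k →
        PointedCone.hull ℝ (x '' (I : Set (Fin N))) = PointedCone.hull ℝ (x '' (J : Set (Fin N))) →
        I ⊆ J := by
      intro I J hJ h i hi
      by_contra hiJ
      refine hx.notMem_span (by omega) hiJ (PointedCone.hull_le_span ℝ _ ?_)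
      rw [← h]
      exact PointedCone.subset_hull ⟨i, hi, rfl⟩
    exact Finset.Subset.antisymm (hsub I J hJ.1 hIJ) (hsub J I hI.1 hIJ.symm)

/-! ### The expected number of faces -/

section Sampling

/-- Projection along a compact factor is a closed map; covering `L` by countably many compact sets
shows that the projection is a countable union of closed sets. -/
theorem measurableSet_exists_of_isClosed {X L : Type*} [TopologicalSpace X] [MeasurableSpace X]
    [OpensMeasurableSpace X] [TopologicalSpace L] [SigmaCompactSpace L] {C : Set (X × L)}
    (hC : IsClosed C) : MeasurableSet {x | ∃ l, (x, l) ∈ C} := by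
  have h : {x | ∃ l, (x, l) ∈ C} = ⋃ n, (Prod.fst : X × compactCovering L n → X) ''
      ((fun p : X × compactCovering L n => (p.1, (p.2 : L))) ⁻¹' C) := by
    ext x
    simp only [Set.mem_ofPred_eq, Set.mem_iUnion, Set.mem_image, Set.mem_preimage, Prod.exists,
      exists_and_right, exists_eq_right, Subtype.exists]
    constructor
    · rintro ⟨l, hl⟩
      obtain ⟨n, hn⟩ := exists_mem_compactCovering l
      exact ⟨n, l, hn, hl⟩
    · rintro ⟨_, l, _, hl⟩
      exact ⟨l, hl⟩
  rw [h]
  refine MeasurableSet.iUnion fun n => IsClosed.measurableSet ?_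
  have : CompactSpace (compactCovering L n) :=
    isCompact_iff_compactSpace.1 (isCompact_compactCovering L n)
  exact isClosedMap_fst_of_compactSpace _ (hC.preimage (by fun_prop))

variable {d : ℕ}

/-- Scaling the coefficients to sum `1` replaces nontriviality by a closed condition, as needed for
measurability. -/
theorem not_acyclic_iff {ι : Type*} {V : Type*} [AddCommGroup V] [Module ℝ V] {x : ι → V}
    {J K : Finset ι} : ¬ Acyclic (Submodule.span ℝ (x '' (K : Set ι))) x J ↔
      ∃ p : (ι → ℝ) × (ι → ℝ), (∀ i ∈ J, 0 ≤ p.1 i) ∧ ∑ i ∈ J, p.1 i = 1 ∧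
        ∑ i ∈ J, p.1 i • x i = ∑ i ∈ K, p.2 i • x i := by
  constructor
  · intro h
    unfold Acyclic at h
    push Not at h
    obtain ⟨c, hc, hU, i, hi, hne⟩ := h
    obtain ⟨a, ha⟩ := (Submodule.mem_span_image_finset_iff_exists_fun' ℝ).1 hU
    have hs : 0 < ∑ i ∈ J, c i :=
      Finset.sum_pos' hc ⟨i, hi, lt_of_le_of_ne (hc i hi) (Ne.symm hne)⟩
    refine ⟨(fun i => (∑ i ∈ J, c i)⁻¹ * c i, fun i => (∑ i ∈ J, c i)⁻¹ * a i), ?_, ?_, ?_⟩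
    · exact fun i hi => mul_nonneg (inv_nonneg.2 hs.le) (hc i hi)
    · rw [← Finset.mul_sum, inv_mul_cancel₀ hs.ne']
    · simp only [mul_smul, ← Finset.smul_sum, ha]
  · rintro ⟨⟨c, a⟩, hc, hs, h⟩ hA
    have := hA c hc ((Submodule.mem_span_image_finset_iff_exists_fun' ℝ).2 ⟨a, h.symm⟩)
    rw [Finset.sum_eq_zero this] at hs
    norm_num at hs

theorem measurableSet_acyclic {N : ℕ} (J K : Finset (Fin N)) :
    MeasurableSet {x : Fin N → E d | Acyclic (Submodule.span ℝ (x '' (K : Set (Fin N)))) x J} := by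
  rw [← MeasurableSet.compl_iff]
  have : {x : Fin N → E d | Acyclic (Submodule.span ℝ (x '' (K : Set (Fin N)))) x J}ᶜ =
      {x | ∃ p : (Fin N → ℝ) × (Fin N → ℝ), (x, p) ∈
        {q : (Fin N → E d) × ((Fin N → ℝ) × (Fin N → ℝ)) | (∀ i ∈ J, 0 ≤ q.2.1 i) ∧
          ∑ i ∈ J, q.2.1 i = 1 ∧ ∑ i ∈ J, q.2.1 i • q.1 i = ∑ i ∈ K, q.2.2 i • q.1 i}} := by
    ext x
    exact not_acyclic_iff
  rw [this]
  refine measurableSet_exists_of_isClosed ?_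
  have h : IsClosed {q : (Fin N → E d) × ((Fin N → ℝ) × (Fin N → ℝ)) |
      ∀ i ∈ J, 0 ≤ q.2.1 i} := by
    have e : {q : (Fin N → E d) × ((Fin N → ℝ) × (Fin N → ℝ)) | ∀ i ∈ J, 0 ≤ q.2.1 i} =
        ⋂ i ∈ J, {q | 0 ≤ q.2.1 i} := by
      ext
      simp
    rw [e]
    exact isClosed_biInter fun i _ => isClosed_le (by fun_prop) (by fun_prop)
  exact h.inter ((isClosed_eq (by fun_prop) (by fun_prop)).inter
    (isClosed_eq (by fun_prop) (by fun_prop)))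

theorem IsAdmissible.measure_subspace {φ : Measure (E d)} (hφ : IsAdmissible φ)
    {U : Submodule ℝ (E d)} (hU : U ≠ ⊤) : φ (U : Set (E d)) = 0 := by
  have : Uᗮ ≠ ⊥ := fun h => hU (Submodule.orthogonal_eq_bot_iff.1 h)
  obtain ⟨v, hv, hv0⟩ := Submodule.exists_mem_ne_zero_of_ne_bot this
  refine measure_mono_null (fun x hx => ?_) (hφ.hyperplane v hv0)
  exact Submodule.inner_left_of_mem_orthogonal hx hv

/-- Fubini, integrating the `j`-th vector first: fewer than `d` other vectors span a proper
subspace, which is `φ`-null. -/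
theorem IsAdmissible.measure_mem_span {φ : Measure (E d)} (hφ : IsAdmissible φ) {N : ℕ}
    {K : Finset (Fin N)} (hK : K.card < d) {j : Fin N} (hj : j ∉ K) :
    Measure.pi (fun _ : Fin N => φ) {x | x j ∈ Submodule.span ℝ (x '' (K : Set (Fin N)))} = 0 := by
  have := hφ.prob
  obtain _ | n := N
  · exact j.elim0
  let K' : Finset (Fin n) := K.preimage j.succAbove (Fin.succAbove_right_injective.injOn)
  have hK' : K = K'.image j.succAbove := by
    ext i
    simp only [Finset.mem_image, K', Finset.mem_preimage]
    constructor
    · intro hi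
      obtain ⟨m, rfl⟩ := Fin.exists_succAbove_eq (x := i) (y := j) (fun e => hj (e ▸ hi))
      exact ⟨m, hi, rfl⟩
    · rintro ⟨m, hm, rfl⟩
      exact hm
  have hcard : K'.card < d := by
    rwa [hK', Finset.card_image_of_injective _ Fin.succAbove_right_injective] at hK
  let B : Set (E d × (Fin n → E d)) :=
    {q | q.1 ∈ Submodule.span ℝ (q.2 '' (K' : Set (Fin n)))}
  have hB : MeasurableSet B := by
    have : B = {q | ∃ c : Fin n → ℝ, (q, c) ∈
        {r : (E d × (Fin n → E d)) × (Fin n → ℝ) | ∑ i ∈ K', r.2 i • r.1.2 i = r.1.1}} := by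
      ext q
      exact Submodule.mem_span_image_finset_iff_exists_fun' ℝ
    rw [this]
    exact measurableSet_exists_of_isClosed (isClosed_eq (by fun_prop) (by fun_prop))
  have hmp := measurePreserving_piFinSuccAbove (fun _ : Fin (n + 1) => φ) j
  have hpre : {x : Fin (n + 1) → E d | x j ∈ Submodule.span ℝ (x '' (K : Set (Fin (n + 1))))} =
      MeasurableEquiv.piFinSuccAbove (fun _ => E d) j ⁻¹' B := by
    ext x
    simp only [B, Set.mem_preimage, Set.mem_ofPred_eq, MeasurableEquiv.piFinSuccAbove_apply]
    have himg : x '' (K : Set (Fin (n + 1))) = (fun i => x (j.succAbove i)) '' (K' : Set (Fin n)) := by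
      rw [hK', Finset.coe_image, Set.image_image]
    rw [himg]
    rfl
  rw [hpre, hmp.measure_preimage hB.nullMeasurableSet, Measure.prod_apply_symm hB]
  refine (lintegral_congr fun w => ?_).trans lintegral_zero
  exact hφ.measure_subspace (span_image_ne_top (finrank_euclideanSpace_fin) hcard)

theorem IsAdmissible.ae_genPos {φ : Measure (E d)} (hφ : IsAdmissible φ) (N : ℕ) :
    ∀ᵐ x ∂Measure.pi (fun _ : Fin N => φ), GenPos d x := by
  have h : ∀ᵐ x ∂Measure.pi (fun _ : Fin N => φ), ∀ (K : Finset (Fin N)) (j : Fin N),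
      K.card < d → j ∉ K → x j ∉ Submodule.span ℝ (x '' (K : Set (Fin N))) := by
    simp only [ae_all_iff]
    intro K j hK hj
    rw [ae_iff]
    simpa using hφ.measure_mem_span hK hj
  filter_upwards [h] with x hx T
  induction T using Finset.induction_on with
  | empty => intro _; simp
  | insert j T hj ih =>
    intro hT
    rw [Finset.card_insert_of_notMem hj] at hT
    rw [Finset.coe_insert, linearIndepOn_insert (by simpa using hj)]
    exact ⟨ih (by omega), hx T j (by omega) hj⟩

theorem IsAdmissible.measurePreserving_signFlip {φ : Measure (E d)} (hφ : IsAdmissible φ) {N : ℕ}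
    (S : Finset (Fin N)) : MeasurePreserving (signFlip S : (Fin N → E d) → Fin N → E d)
      (Measure.pi fun _ => φ) (Measure.pi fun _ => φ) := by
  have := hφ.prob
  refine measurePreserving_pi (fun _ => φ) (fun _ => φ)
    (f := fun i v => if i ∈ S then -v else v) fun i => ?_
  by_cases hi : i ∈ S
  · simpa [hi] using (⟨measurable_neg, hφ.even⟩ : MeasurePreserving (fun v : E d => -v) φ φ)
  · simp only [hi, if_false]
    exact MeasurePreserving.id φ

/-- Each of the `2 ^ J.card` flips preserves the product measure and fixes the vectors in `K`. The
sum of the flipped indicators is almost surely the deterministic sign count. -/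
theorem IsAdmissible.measureReal_acyclic {φ : Measure (E d)} (hφ : IsAdmissible φ) {N : ℕ}
    {J K : Finset (Fin N)} (hJK : Disjoint J K) (hK : K.card ≤ d) :
    (Measure.pi fun _ : Fin N => φ).real
      {x | Acyclic (Submodule.span ℝ (x '' (K : Set (Fin N)))) x J} =
        signCount J.card (d - K.card) / 2 ^ J.card := by
  classical
  have := hφ.prob
  set μ := Measure.pi fun _ : Fin N => φ
  set A := {x : Fin N → E d | Acyclic (Submodule.span ℝ (x '' (K : Set (Fin N)))) x J}
  have hA : MeasurableSet A := measurableSet_acyclic J K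
  rw [eq_div_iff (by positivity), mul_comm]
  have h1 : ∀ S ∈ J.powerset, ∫ x, A.indicator (fun _ => (1 : ℝ)) (signFlip S x) ∂μ = μ.real A := by
    intro S _
    have hS := hφ.measurePreserving_signFlip S
    rw [← integral_indicator_one hA]
    conv_rhs => rw [← show μ.map (signFlip S) = μ from hS.map_eq]
    rw [integral_map hS.measurable.aemeasurable]
    · rfl
    · exact (stronglyMeasurable_one.indicator hA).aestronglyMeasurable
  have h2 : ∫ x, ∑ S ∈ J.powerset, A.indicator (fun _ => (1 : ℝ)) (signFlip S x) ∂μ =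
      2 ^ J.card * μ.real A := by
    rw [integral_finsetSum, Finset.sum_congr rfl h1, Finset.sum_const, Finset.card_powerset]
    · simp
    · intro S _
      have hS := hφ.measurePreserving_signFlip S
      exact hS.integrable_comp_of_integrable ((integrable_const _).indicator hA)
  rw [← h2]
  have h3 : ∀ᵐ x ∂μ, ∑ S ∈ J.powerset, A.indicator (fun _ => (1 : ℝ)) (signFlip S x) =
      signCount J.card (d - K.card) := by
    filter_upwards [hφ.ae_genPos N] with x hx
    rw [← sum_acyclic_signFlip finrank_euclideanSpace_fin hx J K hJK hK, Nat.cast_sum]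
    refine Finset.sum_congr rfl fun S hS => ?_
    have himg : signFlip S x '' (K : Set (Fin N)) = x '' (K : Set (Fin N)) :=
      Set.image_congr fun i hi => signFlip_of_notMem fun h =>
        Finset.disjoint_left.1 hJK (Finset.mem_powerset.1 hS h) hi
    simp only [A, Set.indicator_apply, Set.mem_ofPred_eq, himg]
    push_cast
    rfl
  rw [integral_congr_ae h3]
  simp

/-- The expected number of missing faces, evaluated by Wendel's theorem. -/
def expectedDefect (N d k : ℕ) : ℝ :=
  N.choose k * (1 - signCount (N - k) (d - k) / 2 ^ (N - k))

variable {N k : ℕ} {Ω : Type*} [MeasurableSpace Ω] {P : Measure Ω} {φ : Measure (E d)}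
  {X : Fin N → Ω → E d}

theorem IsAdmissible.numFaces_ae_eq (hφ : IsAdmissible φ) (hk : k < d) :
    (fun x : Fin N → E d => (numFaces k (pos x) : ℝ)) =ᵐ[Measure.pi fun _ => φ]
      fun x => ∑ I ∈ Finset.univ.powersetCard k,
        {x : Fin N → E d | Acyclic (Submodule.span ℝ (x '' (I : Set (Fin N)))) x Iᶜ}.indicator
          (fun _ => (1 : ℝ)) x := by
  classical
  filter_upwards [hφ.ae_genPos N] with x hx
  rw [numFaces_pos_eq hk hx, Nat.cast_sum]
  refine Finset.sum_congr rfl fun I _ => ?_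
  simp only [Set.indicator_apply, Set.mem_ofPred_eq]
  push_cast
  rfl

theorem IsAdmissible.integrable_numFaces (hφ : IsAdmissible φ) (hk : k < d) :
    Integrable (fun x : Fin N → E d => (numFaces k (pos x) : ℝ)) (Measure.pi fun _ => φ) := by
  have := hφ.prob
  refine Integrable.congr ?_ (hφ.numFaces_ae_eq hk).symm
  exact integrable_finsetSum _ fun I _ => (integrable_const _).indicator (measurableSet_acyclic _ _)

theorem IsAdmissible.integral_numFaces (hφ : IsAdmissible φ) (hk : k < d) :
    ∫ x : Fin N → E d, (numFaces k (pos x) : ℝ) ∂(Measure.pi fun _ => φ) =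
      N.choose k * (signCount (N - k) (d - k) / 2 ^ (N - k)) := by
  have := hφ.prob
  rw [integral_congr_ae (hφ.numFaces_ae_eq hk), integral_finsetSum _ fun I _ =>
    (integrable_const _).indicator (measurableSet_acyclic _ _)]
  rw [Finset.sum_congr rfl (g := fun _ => (signCount (N - k) (d - k) / 2 ^ (N - k) : ℝ))]
  · simp
  · intro I hI
    have hI := (Finset.mem_powersetCard.1 hI).2
    have h := hφ.measureReal_acyclic (J := Iᶜ) (K := I) disjoint_compl_left (by omega)
    rw [Finset.card_compl, Fintype.card_fin, hI] at h
    rw [← h]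
    exact integral_indicator_one (measurableSet_acyclic _ _)

theorem IsSample.map_eq (hX : IsSample P φ X) (hN : 0 < N) :
    AEMeasurable (fun ω i => X i ω) P ∧ P.map (fun ω i => X i ω) = Measure.pi fun _ => φ := by
  have := hX.admissible.prob
  have hm : ∀ i, AEMeasurable (X i) P := fun i => (hX.hasLaw i).aemeasurable
  -- `P` is not assumed to be a probability measure; it inherits this from the law of one vector,
  -- which is where `0 < N` enters.
  have hP : IsProbabilityMeasure P := by
    rw [← Measure.isProbabilityMeasure_map_iff (hm ⟨0, hN⟩), (hX.hasLaw ⟨0, hN⟩).map_eq]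
    infer_instance
  refine ⟨aemeasurable_pi_lambda _ hm, ?_⟩
  rw [(iIndepFun_iff_map_fun_eq_pi_map hm).1 hX.indep]
  simp only [(hX.hasLaw _).map_eq]

theorem IsSample.integrable_faceCount (hX : IsSample P φ X) (hN : 0 < N) (hk : k < d) :
    Integrable (faceCount k X) P := by
  obtain ⟨hm, he⟩ := hX.map_eq hN
  have h := hX.admissible.integrable_numFaces (N := N) hk
  rw [← he] at h
  exact h.comp_aemeasurable hm

theorem IsSample.faceDefect_eq (hX : IsSample P φ X) (hN : 0 < N) (hk : k < d) :
    faceDefect P k X = expectedDefect N d k := by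
  obtain ⟨hm, he⟩ := hX.map_eq hN
  have h := hX.admissible.integrable_numFaces (N := N) hk
  have h2 := hX.admissible.integral_numFaces (N := N) hk
  rw [← he] at h h2
  rw [integral_map hm h.aestronglyMeasurable] at h2
  unfold faceDefect faceCount expectedDefect
  rw [h2]
  ring

end Sampling

/-! ### Binomial tails and Stirling's formula -/

section Estimates

theorem signCount_succ_eq (m n : ℕ) :
    signCount (m + 1) n = 2 * ∑ i ∈ Finset.range n, m.choose i := by
  induction m generalizing n with
  | zero =>
    cases n with
    | zero => simp [signCount]
    | succ n => simp [signCount, Finset.sum_range_succ']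
  | succ m ih =>
    cases n with
    | zero => simp [signCount]
    | succ n =>
      rw [signCount, ih, ih, ← mul_add, Finset.sum_range_succ' _ n, Finset.sum_range_succ' _ n]
      simp only [Nat.choose_succ_succ, Finset.sum_add_distrib, Nat.choose_zero_right]
      ring

theorem one_sub_signCount_div {m n : ℕ} (h : n ≤ m + 1) :
    1 - (signCount (m + 1) n : ℝ) / 2 ^ (m + 1) =
      2 * (∑ i ∈ Finset.Ico n (m + 1), (m.choose i : ℝ)) / 2 ^ (m + 1) := by
  have h1 : ((∑ i ∈ Finset.range n, (m.choose i : ℝ)) +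
      ∑ i ∈ Finset.Ico n (m + 1), (m.choose i : ℝ)) = 2 ^ m := by
    rw [Finset.sum_range_add_sum_Ico _ h]
    exact_mod_cast Nat.sum_range_choose m
  rw [signCount_succ_eq, eq_div_iff (by positivity), sub_mul, div_mul_cancel₀ _ (by positivity)]
  push_cast
  rw [pow_succ, ← h1]
  ring

theorem choose_le_sum_Ico {m n : ℕ} (h : n ≤ m) :
    (m.choose n : ℝ) ≤ ∑ i ∈ Finset.Ico n (m + 1), (m.choose i : ℝ) :=
  Finset.single_le_sum (f := fun i => (m.choose i : ℝ)) (fun _ _ => Nat.cast_nonneg _)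
    (Finset.mem_Ico.2 ⟨le_rfl, by omega⟩)

/-- The ratios `(m - n - j) / (n + j + 1)` of successive terms decrease in `j`, and `hq` bounds the
first by `q`; the geometric series dominates. -/
theorem sum_Ico_choose_le {m n : ℕ} {q : ℝ} (hq0 : 0 ≤ q) (hq1 : q < 1)
    (hq : (m : ℝ) - n ≤ q * (n + 1)) :
    ∑ i ∈ Finset.Ico n (m + 1), (m.choose i : ℝ) ≤ m.choose n / (1 - q) := by
  have hstep : ∀ j, (m.choose (n + j) : ℝ) ≤ m.choose n * q ^ j := by
    intro j
    induction j with
    | zero => simp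
    | succ j ih =>
      rcases le_or_gt m (n + j) with hm | hm
      · rw [← add_assoc, Nat.choose_eq_zero_of_lt (by omega)]
        simp only [Nat.cast_zero]
        positivity
      · have h1 : (m.choose (n + j + 1) : ℝ) * (n + j + 1) = m.choose (n + j) * (m - n - j) := by
          have := Nat.choose_succ_right_eq m (n + j)
          have h2 : ((m - (n + j) : ℕ) : ℝ) = (m : ℝ) - n - j := by
            rw [Nat.cast_sub hm.le]; push_cast; ring
          rw [← h2]
          exact_mod_cast this
        have h3 : (m : ℝ) - n - j ≤ q * (n + j + 1) := by
          have : 0 ≤ q * j := by positivity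
          have : (0 : ℝ) ≤ j := by positivity
          nlinarith
        have h4 : (m.choose (n + j + 1) : ℝ) * (n + j + 1) ≤
            (m.choose (n + j) * q) * (n + j + 1) := by
          rw [h1, mul_assoc]
          exact mul_le_mul_of_nonneg_left h3 (Nat.cast_nonneg _)
        rw [← add_assoc]
        refine (le_of_mul_le_mul_right h4 (by positivity)).trans ?_
        rw [pow_succ, ← mul_assoc]
        exact mul_le_mul_of_nonneg_right ih hq0
  rw [Finset.sum_Ico_eq_sum_range, div_eq_mul_inv, ← tsum_geometric_of_lt_one hq0 hq1]
  refine (Finset.sum_le_sum fun j _ => hstep j).trans ?_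
  rw [← Finset.mul_sum]
  exact mul_le_mul_of_nonneg_left
    ((summable_geometric_of_lt_one hq0 hq1).sum_le_tsum _ fun _ _ => by positivity)
    (Nat.cast_nonneg _)

/-- The sequence decreases from its value at `1`. With the lower bound `√π` this gives Stirling
estimates uniform in `n ≥ 1`. -/
theorem stirlingSeq_le {n : ℕ} (hn : n ≠ 0) : Stirling.stirlingSeq n ≤ Real.exp 1 / √2 := by
  obtain ⟨n, rfl⟩ := Nat.exists_eq_succ_of_ne_zero hn
  rw [← Stirling.stirlingSeq_one]
  exact Stirling.stirlingSeq'_antitone (Nat.zero_le n)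

theorem factorial_eq_stirlingSeq {n : ℕ} (hn : n ≠ 0) :
    (n.factorial : ℝ) = Stirling.stirlingSeq n * √(2 * n) * Real.exp (n * Real.log n - n) := by
  have hn0 : (0 : ℝ) < n := by positivity
  have : Real.exp (n * Real.log n - n) = (n / Real.exp 1) ^ n := by
    rw [Real.exp_sub, div_pow, ← Real.exp_nat_mul, mul_one, mul_comm, Real.exp_mul,
      Real.exp_log hn0, Real.rpow_natCast]
  rw [this, Stirling.stirlingSeq]
  field_simp

theorem mul_binEntropy_div {p n : ℝ} (hp : 0 < p) (hpn : p < n) :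
    n * Real.binEntropy (p / n) =
      n * Real.log n - p * Real.log p - (n - p) * Real.log (n - p) := by
  have hn : 0 < n := hp.trans hpn
  have h1 : 1 - p / n = (n - p) / n := by field_simp
  rw [Real.binEntropy, h1, Real.log_inv, Real.log_inv, Real.log_div hp.ne' hn.ne',
    Real.log_div (by linarith) hn.ne']
  field_simp
  ring

/-- Chain rule for entropy: the terms `d log d` cancel, leaving the exponent of a trinomial
coefficient. -/
theorem mul_G {N d k : ℝ} (hk : 0 < k) (hkd : k < d) (hdN : d < N) :
    N * G (d / N) (k / d) = N * Real.log N - k * Real.log k - (d - k) * Real.log (d - k) -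
      (N - d) * Real.log (N - d) - (N - k) * Real.log 2 := by
  have hd := hk.trans hkd
  have hN := hd.trans hdN
  have h1 := mul_binEntropy_div hd hdN
  have h2 := mul_binEntropy_div hk hkd
  have : N * G (d / N) (k / d) = N * Real.binEntropy (d / N) + d * Real.binEntropy (k / d) -
      (N - k) * Real.log 2 := by
    unfold G
    field_simp
  rw [this, h1, h2]
  ring

/-- The factor by which Stirling's formula, without its constant, differs from an exponential
in the evaluation of a trinomial coefficient, times `N`. -/
def stirlingFactor (x y : ℝ) : ℝ := (2 * √(x * y * (x * (1 - y)) * (1 - x)))⁻¹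

theorem stirlingFactor_eq {N d k : ℝ} (hk : 0 < k) (hkd : k < d) (hdN : d < N) :
    stirlingFactor (d / N) (k / d) =
      N * √(2 * N) / (√(2 * k) * √(2 * (d - k)) * √(2 * (N - d))) := by
  have hd := hk.trans hkd
  have hN := hd.trans hdN
  have h1 : 0 < d - k := by linarith
  have h2 : 0 < N - d := by linarith
  have e : d / N * (k / d) * (d / N * (1 - k / d)) * (1 - d / N) = k * (d - k) * (N - d) / N ^ 3 := by
    field_simp
  rw [stirlingFactor, e, ← Real.sqrt_mul (by positivity), ← Real.sqrt_mul (by positivity)]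
  rw [inv_eq_one_div, div_eq_div_iff (by positivity) (by positivity), one_mul]
  have e2 : √(2 * k * (2 * (d - k)) * (2 * (N - d))) =
      √(2 * N) * (2 * N * √(k * (d - k) * (N - d) / N ^ 3)) := by
    rw [← Real.sqrt_sq (by positivity : 0 ≤ 2 * N), ← Real.sqrt_mul (by positivity),
      ← Real.sqrt_mul (by positivity), Real.sqrt_sq (by positivity)]
    congr 1
    field_simp
  rw [e2]
  ring

/-- With `N - k` in place of `N - k - 1` the product would be the trinomial coefficient; the shift
costs the last factor. -/
theorem choose_mul_choose {N d k : ℕ} (hkd : k < d) (hdN : d < N) :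
    (N.choose k : ℝ) * ((N - k - 1).choose (d - k) : ℝ) =
      N.factorial / (k.factorial * (d - k).factorial * (N - d).factorial) *
        (((N : ℝ) - d) / ((N : ℝ) - k)) := by
  obtain ⟨b, rfl⟩ := Nat.exists_eq_add_of_lt hkd
  obtain ⟨c, rfl⟩ := Nat.exists_eq_add_of_lt hdN
  rw [Nat.cast_choose ℝ (by omega), Nat.cast_choose ℝ (by omega)]
  rw [show k + b + 1 + c + 1 - k - 1 = b + c + 1 by omega,
    show k + b + 1 - k = b + 1 by omega, show k + b + 1 + c + 1 - k = b + c + 1 + 1 by omega,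
    show b + c + 1 - (b + 1) = c by omega, show k + b + 1 + c + 1 - (k + b + 1) = c + 1 by omega,
    Nat.factorial_succ (b + c + 1), Nat.factorial_succ c]
  have h : ((k + b + 1 + c + 1 : ℕ) : ℝ) - k = b + c + 1 + 1 := by push_cast; ring
  have h' : ((k + b + 1 + c + 1 : ℕ) : ℝ) - (k + b + 1 : ℕ) = c + 1 := by push_cast; ring
  rw [h, h']
  push_cast
  have h1 : (k.factorial : ℝ) ≠ 0 := by positivity
  have h2 : ((b + 1).factorial : ℝ) ≠ 0 := by positivity
  have h3 : (c.factorial : ℝ) ≠ 0 := by positivity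
  have h4 : ((b + c + 1).factorial : ℝ) ≠ 0 := by positivity
  field_simp

theorem expectedDefect_eq {N d k : ℕ} (hkd : k < d) (hdN : d < N) :
    expectedDefect N d k = N.choose k *
      (2 * (∑ i ∈ Finset.Ico (d - k) (N - k - 1 + 1), ((N - k - 1).choose i : ℝ)) / 2 ^ (N - k)) := by
  have := one_sub_signCount_div (m := N - k - 1) (n := d - k) (by omega)
  rw [show N - k - 1 + 1 = N - k by omega] at this ⊢
  rw [expectedDefect, this]

/-- The expected defect, normalized by its asymptotic order of growth. -/
def normalizedDefect (N d k : ℕ) : ℝ :=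
  expectedDefect N d k * N * Real.exp (-(N * G (d / N) (k / d)))

theorem expectedDefect_eq_normalizedDefect {N d k : ℕ} (hN : 0 < N) :
    expectedDefect N d k =
      1 / (N : ℝ) * Real.exp (N * G (d / N) (k / d)) * normalizedDefect N d k := by
  have : (N : ℝ) ≠ 0 := by positivity
  rw [normalizedDefect, Real.exp_neg]
  have := (Real.exp_pos (N * G (d / N) (k / d))).ne'
  field_simp

/-- `s` collects the four Stirling constants and `t` is the tail divided by its first term; the
remaining factors depend only on `d / N` and `k / d` and hence converge. -/
theorem normalizedDefect_eq {N d k : ℕ} (hk : 1 ≤ k) (hkd : k < d) (hdN : d < N) :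
    ∃ s t : ℝ, √Real.pi / (Real.exp 1 / √2) ^ 3 ≤ s ∧ s ≤ (Real.exp 1 / √2) / √Real.pi ^ 3 ∧
      1 ≤ t ∧ (∀ q : ℝ, 0 ≤ q → q < 1 → (N : ℝ) - d ≤ q * (d - k) → t ≤ 1 / (1 - q)) ∧
      normalizedDefect N d k = 2 * ((1 - d / N) / (1 - d / N * (k / d))) *
        stirlingFactor (d / N) (k / d) * s * t := by
  have hk' : (0 : ℝ) < k := by exact_mod_cast hk
  have hkd' : (k : ℝ) < d := by exact_mod_cast hkd
  have hdN' : (d : ℝ) < N := by exact_mod_cast hdN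
  have hd' := hk'.trans hkd'
  have hN' := hd'.trans hdN'
  have hS : ∀ {n : ℕ}, n ≠ 0 → 0 < Stirling.stirlingSeq n := fun hn =>
    (Real.sqrt_pos.2 Real.pi_pos).trans_le (Stirling.sqrt_pi_le_stirlingSeq hn)
  have hk0 : k ≠ 0 := by omega
  have hb0 : d - k ≠ 0 := by omega
  have hc0 : N - d ≠ 0 := by omega
  have hN0 : N ≠ 0 := by omega
  have hch : 0 < ((N - k - 1).choose (d - k) : ℝ) := by
    exact_mod_cast Nat.choose_pos (by omega)
  set C : ℝ := ((N - k - 1).choose (d - k) : ℝ) with hC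
  set T : ℝ := ∑ i ∈ Finset.Ico (d - k) (N - k - 1 + 1), ((N - k - 1).choose i : ℝ) with hT
  refine ⟨Stirling.stirlingSeq N / (Stirling.stirlingSeq k * Stirling.stirlingSeq (d - k) *
    Stirling.stirlingSeq (N - d)), T / C, ?_, ?_, ?_, ?_, ?_⟩
  · have h1 := hS hk0
    have h2 := hS hb0
    have h3 := hS hc0
    rw [pow_three']
    gcongr
    · exact (hS hN0).le
    · exact Stirling.sqrt_pi_le_stirlingSeq hN0
    · exact stirlingSeq_le hk0
    · exact stirlingSeq_le hb0
    · exact stirlingSeq_le hc0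
  · have hpi := Real.sqrt_pos.2 Real.pi_pos
    have h1 := hS hk0
    have h2 := hS hb0
    have h3 := hS hc0
    rw [pow_three']
    gcongr
    · exact stirlingSeq_le hN0
    · exact Stirling.sqrt_pi_le_stirlingSeq hk0
    · exact Stirling.sqrt_pi_le_stirlingSeq hb0
    · exact Stirling.sqrt_pi_le_stirlingSeq hc0
  · rw [one_le_div hch]
    exact choose_le_sum_Ico (by omega)
  · intro q hq0 hq1 hq
    rw [div_le_iff₀ hch, one_div, mul_comm, ← div_eq_mul_inv]
    refine sum_Ico_choose_le hq0 hq1 ?_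
    rw [Nat.cast_sub hkd.le, Nat.cast_sub (by omega), Nat.cast_sub (by omega)]
    push_cast
    linarith
  · have hmul := choose_mul_choose hkd hdN
    rw [← hC, factorial_eq_stirlingSeq hN0, factorial_eq_stirlingSeq hk0,
      factorial_eq_stirlingSeq hb0, factorial_eq_stirlingSeq hc0, Nat.cast_sub hkd.le,
      Nat.cast_sub hdN.le] at hmul
    -- The linear parts of the exponents cancel because `k + (d - k) + (N - d) = N`.
    have hexp : Real.exp (-(N * G (d / N) (k / d))) =
        Real.exp (k * Real.log k - k) * Real.exp ((d - k) * Real.log (d - k) - (d - k)) *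
          Real.exp ((N - d) * Real.log (N - d) - (N - d)) / Real.exp (N * Real.log N - N) *
          2 ^ (N - k) := by
      have h2 : (2 : ℝ) ^ (N - k) = Real.exp ((N - k) * Real.log 2) := by
        rw [← Nat.cast_sub (by omega : k ≤ N), Real.exp_nat_mul, Real.exp_log (by norm_num)]
      rw [h2, ← Real.exp_add, ← Real.exp_add, ← Real.exp_sub, ← Real.exp_add,
        mul_G hk' hkd' hdN']
      congr 1
      ring
    have hu : (1 - (d : ℝ) / N) / (1 - d / N * (k / d)) = (N - d) / (N - k) := by
      have : (N : ℝ) - k ≠ 0 := by linarith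
      have h3 : 1 - (d : ℝ) / N * (k / d) = (N - k) / N := by field_simp
      have h4 : 1 - (d : ℝ) / N = (N - d) / N := by field_simp
      rw [h3, h4]
      field_simp
    rw [normalizedDefect, expectedDefect_eq hkd hdN, ← hT, hexp, hu,
      stirlingFactor_eq hk' hkd' hdN']
    have e0 : (N.choose k : ℝ) = (N.choose k * C) / C := by field_simp
    rw [e0, hmul]
    have h1 := hS hk0
    have h2 := hS hb0
    have h3 := hS hc0
    have h5 : 0 < (d : ℝ) - k := by linarith
    have h6 : 0 < (N : ℝ) - d := by linarith
    have h7 : 0 < (N : ℝ) - k := by linarith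
    have h8 : 0 < √(2 * (k : ℝ)) := by positivity
    have h9 : 0 < √(2 * ((d : ℝ) - k)) := by positivity
    have h10 : 0 < √(2 * ((N : ℝ) - d)) := by positivity
    have h11 := Real.exp_pos (k * Real.log k - k)
    have h12 := Real.exp_pos ((d - k) * Real.log (d - k) - (d - k))
    have h13 := Real.exp_pos ((N - d) * Real.log (N - d) - (N - d))
    have h14 := Real.exp_pos (N * Real.log N - N)
    generalize Real.exp (k * Real.log k - k) = E1 at *
    generalize Real.exp ((d - k) * Real.log (d - k) - (d - k)) = E2 at *
    generalize Real.exp ((N - d) * Real.log (N - d) - (N - d)) = E3 at *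
    generalize Real.exp (N * Real.log N - N) = E4 at *
    generalize √(2 * (k : ℝ)) = R1 at *
    generalize √(2 * ((d : ℝ) - k)) = R2 at *
    generalize √(2 * ((N : ℝ) - d)) = R3 at *
    field_simp

theorem normalizedDefect_pos {N d k : ℕ} (hk : 1 ≤ k) (hkd : k < d) (hdN : d < N) :
    0 < normalizedDefect N d k := by
  have hch : 0 < ((N - k - 1).choose (d - k) : ℝ) := by
    exact_mod_cast Nat.choose_pos (by omega)
  have hch' : 0 < (N.choose k : ℝ) := by
    exact_mod_cast Nat.choose_pos (by omega)
  have hT := hch.trans_le (choose_le_sum_Ico (m := N - k - 1) (n := d - k) (by omega))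
  have hN : (0 : ℝ) < N := by
    have : 0 < N := by omega
    exact_mod_cast this
  rw [normalizedDefect, expectedDefect_eq hkd hdN]
  positivity

end Estimates

/-! ### The sign of `G` and the noncritical limits -/

section Asymptotics

variable {δ ρ : ℝ}

/-- Here `G δ 1 = H(δ) - (1 - δ) log 2`, and the chord of `H` from `1/2` to `1` has the value `2 (1
- δ) log 2` at `δ`. -/
theorem G_one_pos (h1 : 1 / 2 < δ) (h2 : δ < 1) : 0 < G δ 1 := by
  have := Real.strictConcave_binEntropy.2
    (by norm_num : (1 : ℝ) ∈ Set.Icc (0 : ℝ) 1) (by norm_num : (2⁻¹ : ℝ) ∈ Set.Icc (0 : ℝ) 1)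
    (by norm_num) (by linarith : (0 : ℝ) < 2 * δ - 1) (by linarith : (0 : ℝ) < 2 - 2 * δ) (by ring)
  simp only [smul_eq_mul, Real.binEntropy_one, Real.binEntropy_two_inv] at this
  rw [show (2 * δ - 1) * 1 + (2 - 2 * δ) * 2⁻¹ = δ by ring] at this
  have h := mul_pos (sub_pos.2 h2) (Real.log_pos one_lt_two)
  simp only [G, Real.binEntropy_one]
  linarith

/-- Concavity on `[p, 1]`, cleared of denominators: `G δ` is `δ * H` plus an affine function. -/
theorem G_concave (hδ : 0 ≤ δ) {p q : ℝ} (hp : 0 ≤ p) (hpq : p ≤ q) (hq : q ≤ 1) :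
    (1 - q) * G δ p + (q - p) * G δ 1 ≤ (1 - p) * G δ q := by
  rcases (hpq.trans hq).eq_or_lt with rfl | hp1
  · have : q = 1 := le_antisymm hq hpq
    simp [this]
  have hd : 0 < 1 - p := by linarith
  have := Real.strictConcave_binEntropy.concaveOn.2
    (⟨hp, hp1.le⟩ : p ∈ Set.Icc (0 : ℝ) 1) (by norm_num : (1 : ℝ) ∈ Set.Icc (0 : ℝ) 1)
    (div_nonneg (by linarith) hd.le : 0 ≤ (1 - q) / (1 - p))
    (div_nonneg (by linarith) hd.le : 0 ≤ (q - p) / (1 - p)) (by field_simp; ring)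
  simp only [smul_eq_mul, Real.binEntropy_one] at this
  rw [show (1 - q) / (1 - p) * p + (q - p) / (1 - p) * 1 = q by field_simp; ring, mul_zero,
    add_zero, div_mul_eq_mul_div, div_le_iff₀ hd] at this
  have h2 := mul_le_mul_of_nonneg_left this hδ
  simp only [G, Real.binEntropy_one]
  linarith

theorem rhoS_lt_one (h1 : 1 / 2 < δ) (h2 : δ < 1) : rhoS δ < 1 := by
  obtain ⟨hS, hG⟩ := (eq_rhoS_iff h1 h2 (rhoS δ)).1 rfl
  refine lt_of_le_of_ne hS.2 fun e => ?_
  rw [e] at hG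
  exact (G_one_pos h1 h2).ne' hG

/-- A lower bound for the slope of `G(δ, ·)` at its zero `ρ_S(δ)`. -/
def slopeG (δ : ℝ) : ℝ := G δ 1 / (1 - rhoS δ)

theorem slopeG_pos (h1 : 1 / 2 < δ) (h2 : δ < 1) : 0 < slopeG δ :=
  div_pos (G_one_pos h1 h2) (by linarith [rhoS_lt_one h1 h2])

theorem le_G_of_rhoS_le (h1 : 1 / 2 < δ) (h2 : δ < 1) {y : ℝ} (hy : rhoS δ ≤ y) (hy1 : y ≤ 1) :
    slopeG δ * (y - rhoS δ) ≤ G δ y := by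
  obtain ⟨hS, hG⟩ := (eq_rhoS_iff h1 h2 (rhoS δ)).1 rfl
  have := G_concave (by linarith : 0 ≤ δ) hS.1 hy hy1
  have hd : 0 < 1 - rhoS δ := by linarith [rhoS_lt_one h1 h2]
  rw [slopeG, div_mul_eq_mul_div, div_le_iff₀ hd]
  rw [hG] at this
  linarith

/-- To the left of the zero, a concave graph stays below the extension of its chord from `ρ_S` to
`1`. -/
theorem G_le_of_le_rhoS (h1 : 1 / 2 < δ) (h2 : δ < 1) {y : ℝ} (hy0 : 0 ≤ y) (hy : y ≤ rhoS δ) :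
    G δ y ≤ -(slopeG δ * (rhoS δ - y)) := by
  obtain ⟨hS, hG⟩ := (eq_rhoS_iff h1 h2 (rhoS δ)).1 rfl
  have := G_concave (by linarith : 0 ≤ δ) hy0 hy hS.2
  have hd : 0 < 1 - rhoS δ := by linarith [rhoS_lt_one h1 h2]
  rw [slopeG, div_mul_eq_mul_div, ← neg_div, le_div_iff₀ hd]
  rw [hG] at this
  linarith

theorem rhoW_eq (h1 : 1 / 2 < δ) : rhoW δ = 2 - δ⁻¹ := by
  have : δ⁻¹ < 2 := by
    rw [inv_lt_comm₀ (by linarith) (by norm_num)]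
    linarith
  exact max_eq_right (by linarith)

variable {d₀ : ℕ} {N k : ℕ → ℕ}

theorem IsGrowth.eventually_bounds (h : IsGrowth δ ρ d₀ N k) (h1 : 1 / 2 < δ) (h2 : δ < 1)
    (hρ : 0 < ρ) (hρW : ρ < rhoW δ) :
    ∃ A B : ℝ, 0 < A ∧ 0 < B ∧ ∀ᶠ d in atTop,
      A ≤ normalizedDefect (N d) d (k d) ∧ normalizedDefect (N d) d (k d) ≤ B := by
  rw [rhoW_eq h1] at hρW
  have hδ0 : 0 < δ := by linarith
  have hinv : 1 < δ⁻¹ := (one_lt_inv₀ hδ0).2 h2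
  have hρ1 : ρ < 1 := by linarith
  have hδρ : 0 < 1 - δ * ρ := by nlinarith
  have hx := h.tendsto_delta
  have hy := h.tendsto_rho
  have hu : Tendsto (fun d : ℕ => (1 - (d : ℝ) / N d) / (1 - (d : ℝ) / N d * ((k d : ℝ) / d))) atTop
      (𝓝 ((1 - δ) / (1 - δ * ρ))) :=
    (hx.const_sub 1).div ((hx.mul hy).const_sub 1) hδρ.ne'
  have hprod : 0 < δ * ρ * (δ * (1 - ρ)) * (1 - δ) :=
    mul_pos (mul_pos (mul_pos hδ0 hρ) (mul_pos hδ0 (by linarith))) (by linarith)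
  have hr : Tendsto (fun d : ℕ => stirlingFactor ((d : ℝ) / N d) ((k d : ℝ) / d)) atTop
      (𝓝 (stirlingFactor δ ρ)) := by
    refine Tendsto.inv₀ ?_ (by positivity)
    exact ((((hx.mul hy).mul (hx.mul (hy.const_sub 1))).mul (hx.const_sub 1)).sqrt).const_mul 2
  have hq : Tendsto (fun d : ℕ => (((d : ℝ) / N d)⁻¹ - 1) / (1 - (k d : ℝ) / d)) atTop
      (𝓝 ((δ⁻¹ - 1) / (1 - ρ))) :=
    ((hx.inv₀ hδ0.ne').sub_const 1).div (hy.const_sub 1) (by linarith)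
  -- This is `ρ < 2 - 1/δ` rearranged. The left side is the limit of `(N - d) / (d - k)`, so any `Q`
  -- strictly between it and `1` eventually serves as geometric ratio.
  have hq1 : (δ⁻¹ - 1) / (1 - ρ) < 1 := by
    rw [div_lt_one (by linarith)]
    linarith
  obtain ⟨Q, hQ, hQ1⟩ := exists_between hq1
  have hQ0 : 0 < Q := lt_trans (div_pos (by linarith) (by linarith)) hQ
  have hm := (hu.const_mul 2).mul hr
  set M := 2 * ((1 - δ) / (1 - δ * ρ)) * stirlingFactor δ ρ with hM
  have hM0 : 0 < M := by
    have : 0 < 1 - δ := by linarith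
    have : 0 < stirlingFactor δ ρ := by unfold stirlingFactor; positivity
    positivity
  set cl := √Real.pi / (Real.exp 1 / √2) ^ 3
  set cu := (Real.exp 1 / √2) / √Real.pi ^ 3
  have hpi := Real.sqrt_pos.2 Real.pi_pos
  have hcl : 0 < cl := by positivity
  have hcu : 0 < cu := by positivity
  refine ⟨M / 2 * cl, 2 * M * cu * (1 / (1 - Q)), by positivity, ?_, ?_⟩
  · have : 0 < 1 - Q := by linarith
    positivity
  filter_upwards [hm.eventually (lt_mem_nhds (half_lt_self hM0)),
    hm.eventually (gt_mem_nhds (by linarith : M < 2 * M)), hq.eventually (gt_mem_nhds hQ),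
    eventually_ge_atTop d₀] with d hd1 hd2 hd3 hd4
  have hkd := h.lt_dim d hd4
  have hdN := h.dim_lt d hd4
  obtain ⟨s, t, hs, hs', ht, ht', he⟩ := normalizedDefect_eq (h.one_le d hd4) hkd hdN
  have hkd' : (k d : ℝ) < d := by exact_mod_cast hkd
  have hdN' : (d : ℝ) < N d := by exact_mod_cast hdN
  have hd' : (0 : ℝ) < d := (Nat.cast_nonneg _).trans_lt hkd'
  have htQ : t ≤ 1 / (1 - Q) := by
    refine ht' Q hQ0.le hQ1 ?_
    have e : (((d : ℝ) / N d)⁻¹ - 1) / (1 - (k d : ℝ) / d) = (N d - d) / (d - k d) := by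
      have : (d : ℝ) - k d ≠ 0 := by linarith
      have e2 : 1 - (k d : ℝ) / d = (d - k d) / d := by field_simp
      rw [e2, inv_div]
      field_simp
    rw [e, div_lt_iff₀ (by linarith)] at hd3
    exact hd3.le
  have hM2 : 0 < M / 2 := by positivity
  have hs0 : 0 < s := hcl.trans_le hs
  have ht0 : 0 < t := by linarith
  have hw := hM2.trans hd1
  rw [he]
  generalize 2 * ((1 - (d : ℝ) / N d) / (1 - (d : ℝ) / N d * ((k d : ℝ) / d))) *
    stirlingFactor ((d : ℝ) / N d) ((k d : ℝ) / d) = w at *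
  constructor
  · calc M / 2 * cl ≤ w * s := by gcongr
      _ = w * s * 1 := (mul_one _).symm
      _ ≤ w * s * t := by gcongr
  · gcongr

/-- The finitely many remaining dimensions have positive values, which are absorbed into the
constants by minima and maxima. -/
theorem IsGrowth.exists_bounds (h : IsGrowth δ ρ d₀ N k) (h1 : 1 / 2 < δ) (h2 : δ < 1)
    (hρ : 0 < ρ) (hρW : ρ < rhoW δ) :
    ∃ a b : ℝ, 0 < a ∧ 0 < b ∧ ∀ d ≥ d₀, normalizedDefect (N d) d (k d) ∈ Set.Icc a b := by
  obtain ⟨A, B, hA, hB, hev⟩ := h.eventually_bounds h1 h2 hρ hρW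
  obtain ⟨D, hD⟩ := eventually_atTop.1 hev
  have hfin : ∀ D, ∃ a b : ℝ, 0 < a ∧ 0 < b ∧ ∀ d ≥ d₀, d < D →
      normalizedDefect (N d) d (k d) ∈ Set.Icc a b := by
    intro D
    induction D with
    | zero => exact ⟨1, 1, one_pos, one_pos, fun d _ hd => absurd hd (Nat.not_lt_zero d)⟩
    | succ D ih =>
      obtain ⟨a, b, ha, hb, hab⟩ := ih
      by_cases hDd : d₀ ≤ D
      · have hpos := normalizedDefect_pos (h.one_le D hDd) (h.lt_dim D hDd) (h.dim_lt D hDd)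
        refine ⟨min a (normalizedDefect (N D) D (k D)), max b (normalizedDefect (N D) D (k D)),
          lt_min ha hpos, lt_max_of_lt_left hb, fun d hd hdD => ?_⟩
        rcases (Nat.lt_succ_iff.1 hdD).eq_or_lt with rfl | hlt
        · exact ⟨min_le_right _ _, le_max_right _ _⟩
        · have := hab d hd hlt
          exact ⟨(min_le_left _ _).trans this.1, this.2.trans (le_max_left _ _)⟩
      · exact ⟨a, b, ha, hb, fun d hd hdD => absurd (hd.trans (Nat.lt_succ_iff.1 hdD)) hDd⟩
  obtain ⟨a, b, ha, hb, hab⟩ := hfin D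
  refine ⟨min a A, max b B, lt_min ha hA, lt_max_of_lt_left hb, fun d hd => ?_⟩
  rcases lt_or_ge d D with hlt | hge
  · have := hab d hd hlt
    exact ⟨(min_le_left _ _).trans this.1, this.2.trans (le_max_left _ _)⟩
  · have := hD d hge
    exact ⟨(min_le_right _ _).trans this.1, this.2.trans (le_max_right _ _)⟩

theorem IsGrowth.expectedDefect_pos (h : IsGrowth δ ρ d₀ N k) {d : ℕ} (hd : d₀ ≤ d) :
    0 < expectedDefect (N d) d (k d) := by
  have hN : 0 < N d := by have := h.dim_lt d hd; omega
  have := normalizedDefect_pos (h.one_le d hd) (h.lt_dim d hd) (h.dim_lt d hd)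
  rw [expectedDefect_eq_normalizedDefect hN]
  positivity

/-- The sign condition is imposed dimension by dimension, so that the bound also applies along a
subsequence in the critical case. -/
theorem IsGrowth.expectedDefect_le (h : IsGrowth δ ρ d₀ N k) (h1 : 1 / 2 < δ) (h2 : δ < 1)
    (hρ : 0 < ρ) (hρW : ρ < rhoW δ) :
    ∃ C : ℝ, ∀ᶠ d : ℕ in atTop, N d * G (d / N d) (k d / d) ≤ 0 →
      expectedDefect (N d) d (k d) ≤ C / d := by
  obtain ⟨a, b, ha, hb, hab⟩ := h.exists_bounds h1 h2 hρ hρW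
  refine ⟨b, ?_⟩
  filter_upwards [eventually_ge_atTop d₀] with d hd hG
  have hkd := h.lt_dim d hd
  have hdN := h.dim_lt d hd
  have hd0 : (0 : ℝ) < d := by have : 0 < d := by omega
                               exact_mod_cast this
  have hdN' : (d : ℝ) ≤ N d := by exact_mod_cast hdN.le
  have hpos := normalizedDefect_pos (h.one_le d hd) hkd hdN
  rw [expectedDefect_eq_normalizedDefect (by omega)]
  calc 1 / (N d : ℝ) * Real.exp (N d * G (d / N d) (k d / d)) * normalizedDefect (N d) d (k d)
      ≤ 1 / (d : ℝ) * 1 * b := by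
        gcongr
        · exact Real.exp_le_one_iff.2 hG
        · exact (hab d hd).2
    _ = b / d := by ring

theorem IsGrowth.le_expectedDefect (h : IsGrowth δ ρ d₀ N k) (h1 : 1 / 2 < δ) (h2 : δ < 1)
    (hρ : 0 < ρ) (hρW : ρ < rhoW δ) {c : ℝ} (hc : 0 < c) :
    ∃ C : ℝ, 0 < C ∧ ∀ᶠ d : ℕ in atTop, c * √d ≤ N d * G (d / N d) (k d / d) →
      C * d ≤ expectedDefect (N d) d (k d) := by
  obtain ⟨a, b, ha, hb, hab⟩ := h.exists_bounds h1 h2 hρ hρW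
  refine ⟨1 / 2 * (c ^ 4 / 24) * a, by positivity, ?_⟩
  filter_upwards [eventually_ge_atTop d₀, h.tendsto_delta.eventually (lt_mem_nhds h1)]
    with d hd hd2 hG
  have hkd := h.lt_dim d hd
  have hdN := h.dim_lt d hd
  have hd0 : (0 : ℝ) < d := by have : 0 < d := by omega
                               exact_mod_cast this
  have hN0 : (0 : ℝ) < N d := by have : 0 < N d := by omega
                                 exact_mod_cast this
  -- The fourth-order term of `exp (c √d)` is of order `d ^ 2` and beats the prefactor `1 / N`,
  -- which exceeds `1 / (2 d)` as `d / N > 1/2`.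
  have hexp : c ^ 4 / 24 * (d : ℝ) ^ 2 ≤ Real.exp (N d * G (d / N d) (k d / d)) := by
    refine le_trans ?_ (Real.exp_le_exp.2 hG)
    refine le_trans (le_of_eq ?_) (Real.pow_div_factorial_le_exp (c * √d) (by positivity) 4)
    rw [mul_pow, show (√(d : ℝ)) ^ 4 = (√(d : ℝ) ^ 2) ^ 2 by ring, Real.sq_sqrt hd0.le]
    norm_num [Nat.factorial]
    ring
  have hN : 1 / 2 * (1 / (d : ℝ)) ≤ 1 / N d := by
    rw [lt_div_iff₀ hN0] at hd2
    rw [one_div_mul_one_div, one_div_le_one_div (by positivity) hN0]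
    linarith
  rw [expectedDefect_eq_normalizedDefect (by omega)]
  calc 1 / 2 * (c ^ 4 / 24) * a * d = 1 / 2 * (1 / (d : ℝ)) * (c ^ 4 / 24 * (d : ℝ) ^ 2) * a := by
        field_simp
    _ ≤ _ := by
      gcongr
      exact (hab d hd).1

theorem IsGrowth.tendsto_G (h : IsGrowth δ ρ d₀ N k) :
    Tendsto (fun d : ℕ => G (d / N d) (k d / d)) atTop (𝓝 (G δ ρ)) := by
  have hx := h.tendsto_delta
  have hy := h.tendsto_rho
  have hH := Real.binEntropy_continuous
  exact (((hH.tendsto δ).comp hx).add (hx.mul ((hH.tendsto ρ).comp hy))).sub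
    (((hy.mul hx).const_sub 1).mul_const _)

theorem IsGrowth.tendsto_expectedDefect_zero (h : IsGrowth δ ρ d₀ N k) (h1 : 1 / 2 < δ)
    (h2 : δ < 1) (hρ : 0 < ρ) (hρW : ρ < rhoW δ) (hρS : ρ < rhoS δ) :
    Tendsto (fun d => expectedDefect (N d) d (k d)) atTop (𝓝 0) := by
  have hG : G δ ρ < 0 := by
    have := G_le_of_le_rhoS h1 h2 hρ.le hρS.le
    have := mul_pos (slopeG_pos h1 h2) (sub_pos.2 hρS)
    linarith
  obtain ⟨C, hC⟩ := h.expectedDefect_le h1 h2 hρ hρW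
  refine squeeze_zero' ?_ ?_ (tendsto_const_div_atTop_nhds_zero_nat C)
  · filter_upwards [eventually_ge_atTop d₀] with d hd
    exact (h.expectedDefect_pos hd).le
  · filter_upwards [hC, h.tendsto_G.eventually (gt_mem_nhds hG)] with d hd hGd
    exact hd (mul_nonpos_of_nonneg_of_nonpos (Nat.cast_nonneg _) hGd.le)

theorem IsGrowth.tendsto_expectedDefect_atTop (h : IsGrowth δ ρ d₀ N k) (h1 : 1 / 2 < δ)
    (h2 : δ < 1) (hρ : 0 < ρ) (hρW : ρ < rhoW δ) (hρS : rhoS δ < ρ) :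
    Tendsto (fun d => expectedDefect (N d) d (k d)) atTop atTop := by
  have hρ1 : ρ ≤ 1 := by
    rw [rhoW_eq h1] at hρW
    have := (one_lt_inv₀ (by linarith : 0 < δ)).2 h2
    linarith
  have hG : 0 < G δ ρ := by
    have := le_G_of_rhoS_le h1 h2 hρS.le hρ1
    have := mul_pos (slopeG_pos h1 h2) (sub_pos.2 hρS)
    linarith
  obtain ⟨C, hC0, hC⟩ := h.le_expectedDefect h1 h2 hρ hρW (half_pos hG)
  refine tendsto_atTop_mono' _ ?_ (tendsto_natCast_atTop_atTop.const_mul_atTop hC0)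
  filter_upwards [hC, h.tendsto_G.eventually (lt_mem_nhds (half_lt_self hG)),
    eventually_ge_atTop d₀] with d hd hGd hdd
  refine hd ?_
  have hdN : (d : ℝ) ≤ N d := by exact_mod_cast (h.dim_lt d hdd).le
  have hd1 : (1 : ℝ) ≤ d := by
    have := h.lt_dim d hdd
    have : 1 ≤ d := by omega
    exact_mod_cast this
  have hsq : √(d : ℝ) ≤ d := Real.sqrt_le_iff.2 ⟨by linarith, by nlinarith⟩
  calc G δ ρ / 2 * √(d : ℝ) ≤ G (d / N d) (k d / d) * N d := by
        gcongr
        · linarith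
        · exact hsq.trans hdN
    _ = _ := mul_comm _ _

/-- Apart from `H(x)`, which is differentiable at `δ`, `G x y` is affine in `x` with slope `H(y) + y
log 2 ≤ 2 log 2`; hence the bound is uniform in `y`. -/
theorem exists_abs_G_sub_le (h1 : 0 < δ) (h2 : δ < 1) :
    ∃ L : ℝ, 0 < L ∧ ∀ᶠ x in 𝓝 δ, ∀ y ∈ Set.Icc (0 : ℝ) 1, |G x y - G δ y| ≤ L * |x - δ| := by
  obtain ⟨c, hc0, hc⟩ := (Real.hasDerivAt_binEntropy h1.ne' h2.ne).isBigO_sub.exists_pos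
  have hlog := Real.log_pos one_lt_two
  refine ⟨c + 2 * Real.log 2, by positivity, ?_⟩
  filter_upwards [hc.bound] with x hx y hy
  have e : G x y - G δ y = (Real.binEntropy x - Real.binEntropy δ) +
      (Real.binEntropy y + y * Real.log 2) * (x - δ) := by
    unfold G
    ring
  rw [e, add_mul c]
  refine (abs_add_le _ _).trans (add_le_add hx ?_)
  rw [abs_mul]
  gcongr
  have hH0 := Real.binEntropy_nonneg hy.1 hy.2
  have hH1 : Real.binEntropy y ≤ Real.log 2 := Real.binEntropy_le_log_two
  have h3 := mul_nonneg hy.1 hlog.le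
  have h4 := mul_le_mul_of_nonneg_right hy.2 hlog.le
  rw [abs_of_nonneg (by linarith)]
  linarith

end Asymptotics

/-! ### The critical case `ρ = ρ_S(δ)` -/

section Critical

/-- Numbers of vectors with `d / N → δ`. -/
def criticalN (δ : ℝ) (d : ℕ) : ℕ := ⌈(d : ℝ) / δ⌉₊

/-- The proportion `ρ`, perturbed upwards for even `d` and downwards for odd `d`. -/
def perturbed (ρ : ℝ) (d : ℕ) : ℝ := ρ + (if Even d then 1 else -1) / √(d : ℝ)

/-- Dimensions `k` with `k / d → ρ`, such that `k / d - ρ` has order `± 1 / √d`, with alternating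
signs. -/
def criticalK (ρ : ℝ) (d : ℕ) : ℕ := max 1 (min (d - 1) ⌊perturbed ρ d * d⌋₊)

variable {δ ρ : ℝ}

theorem tendsto_inv_sqrt_natCast : Tendsto (fun d : ℕ => (√(d : ℝ))⁻¹) atTop (𝓝 0) :=
  tendsto_inv_atTop_zero.comp (Real.tendsto_sqrt_atTop.comp tendsto_natCast_atTop_atTop)

theorem abs_div_criticalN_sub_le (hδ : 0 < δ) {d : ℕ} (hd : 0 < d) :
    |(d : ℝ) / criticalN δ d - δ| ≤ δ / d * δ := by
  have hd' : (0 : ℝ) < d := by exact_mod_cast hd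
  have h1 : (d : ℝ) / δ ≤ criticalN δ d := Nat.le_ceil _
  have h2 : (criticalN δ d : ℝ) < d / δ + 1 := Nat.ceil_lt_add_one (by positivity)
  have h0 : 0 < (d : ℝ) / δ := by positivity
  have hN := h0.trans_le h1
  have e : (d : ℝ) / criticalN δ d - δ = -((criticalN δ d - d / δ) * δ / criticalN δ d) := by
    field_simp
    ring
  rw [e, abs_neg, abs_of_nonneg (div_nonneg (mul_nonneg (by linarith) hδ.le) hN.le)]
  rw [div_le_iff₀ hN]
  calc (criticalN δ d - d / δ) * δ ≤ 1 * δ := by gcongr; linarith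
    _ = δ / d * δ * (d / δ) := by field_simp
    _ ≤ _ := by gcongr

theorem tendsto_div_criticalN (hδ : 0 < δ) :
    Tendsto (fun d : ℕ => (d : ℝ) / criticalN δ d) atTop (𝓝 δ) := by
  rw [tendsto_iff_dist_tendsto_zero]
  have h : Tendsto (fun d : ℕ => δ / (d : ℝ) * δ) atTop (𝓝 0) := by
    simpa using (tendsto_const_div_atTop_nhds_zero_nat δ).mul_const δ
  refine squeeze_zero' (Eventually.of_forall fun d => dist_nonneg) ?_ h
  filter_upwards [eventually_gt_atTop 0] with d hd
  exact abs_div_criticalN_sub_le hδ hd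

theorem tendsto_perturbed (ρ : ℝ) : Tendsto (perturbed ρ) atTop (𝓝 ρ) := by
  rw [tendsto_iff_dist_tendsto_zero]
  refine squeeze_zero (fun d => dist_nonneg) (fun d => ?_) tendsto_inv_sqrt_natCast
  rw [Real.dist_eq, perturbed, add_sub_cancel_left, abs_div, abs_of_nonneg (Real.sqrt_nonneg _)]
  split_ifs <;> simp

/-- The truncation only secures `1 ≤ k < d` in small dimensions. -/
theorem eventually_criticalK_eq (h0 : 0 < ρ) (h1 : ρ < 1) :
    ∀ᶠ d in atTop, criticalK ρ d = ⌊perturbed ρ d * d⌋₊ ∧ 0 ≤ perturbed ρ d := by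
  have hlow := tendsto_natCast_atTop_atTop (R := ℝ) |>.eventually_ge_atTop (2 / ρ)
  filter_upwards [(tendsto_perturbed ρ).eventually (lt_mem_nhds (half_lt_self h0)),
    (tendsto_perturbed ρ).eventually (gt_mem_nhds h1), hlow, eventually_gt_atTop 0]
    with d hd1 hd2 hd3 hd4
  have hd' : (0 : ℝ) < d := by exact_mod_cast hd4
  have hp : 0 ≤ perturbed ρ d := by linarith
  refine ⟨?_, hp⟩
  have h3 : 1 ≤ ⌊perturbed ρ d * d⌋₊ := by
    rw [Nat.one_le_floor_iff]
    rw [div_le_iff₀ h0] at hd3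
    nlinarith
  have h4 : ⌊perturbed ρ d * d⌋₊ < d := by
    rw [Nat.floor_lt (by positivity)]
    nlinarith
  rw [criticalK, min_eq_right (by omega), max_eq_right h3]

theorem eventually_criticalK_div (h0 : 0 < ρ) (h1 : ρ < 1) :
    ∀ᶠ d : ℕ in atTop, perturbed ρ d - 1 / d ≤ (criticalK ρ d : ℝ) / d ∧
      (criticalK ρ d : ℝ) / d ≤ perturbed ρ d := by
  filter_upwards [eventually_criticalK_eq h0 h1, eventually_gt_atTop 0] with d ⟨hd, hp⟩ hd0
  have hd' : (0 : ℝ) < d := by exact_mod_cast hd0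
  rw [hd]
  constructor
  · rw [le_div_iff₀ hd', sub_mul, one_div_mul_cancel hd'.ne']
    linarith [Nat.lt_floor_add_one (perturbed ρ d * d)]
  · rw [div_le_iff₀ hd']
    exact Nat.floor_le (by positivity)

theorem isGrowth_critical (hδ : 0 < δ) (hδ1 : δ < 1) (h0 : 0 < ρ) (h1 : ρ < 1) :
    IsGrowth δ ρ 2 (criticalN δ) (criticalK ρ) where
  one_le d _ := le_max_left _ _
  lt_dim d hd := by
    have : min (d - 1) ⌊perturbed ρ d * d⌋₊ ≤ d - 1 := min_le_left _ _
    exact max_lt (by omega) (by omega)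
  dim_lt d hd := by
    rw [criticalN, Nat.lt_ceil, lt_div_iff₀ hδ]
    have : (0 : ℝ) < d := by
      have : 0 < d := by omega
      exact_mod_cast this
    nlinarith
  tendsto_delta := tendsto_div_criticalN hδ
  tendsto_rho := by
    have h : Tendsto (fun d : ℕ => perturbed ρ d - 1 / d) atTop (𝓝 ρ) := by
      simpa using (tendsto_perturbed ρ).sub (tendsto_const_div_atTop_nhds_zero_nat (1 : ℝ))
    refine tendsto_of_tendsto_of_tendsto_of_le_of_le' h (tendsto_perturbed ρ) ?_ ?_ <;>
      filter_upwards [eventually_criticalK_div h0 h1] with d hd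
    exacts [hd.1, hd.2]

theorem eventually_abs_G_critical_sub_le (hδ : 0 < δ) (hδ1 : δ < 1) :
    ∃ L : ℝ, 0 < L ∧ ∀ᶠ d : ℕ in atTop, ∀ y ∈ Set.Icc (0 : ℝ) 1,
      |G ((d : ℝ) / criticalN δ d) y - G δ y| ≤ L / d := by
  obtain ⟨L, hL, h⟩ := exists_abs_G_sub_le hδ hδ1
  refine ⟨L, hL, ?_⟩
  filter_upwards [(tendsto_div_criticalN hδ).eventually h, eventually_gt_atTop 0] with d hd hd0 y hy
  have hd' : (0 : ℝ) < d := by exact_mod_cast hd0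
  refine (hd y hy).trans ?_
  rw [div_eq_mul_one_div L]
  refine mul_le_mul_of_nonneg_left ((abs_div_criticalN_sub_le hδ hd0).trans ?_) hL.le
  rw [div_mul_eq_mul_div]
  gcongr
  nlinarith

theorem tendsto_sqrt_natCast_atTop : Tendsto (fun d : ℕ => √(d : ℝ)) atTop atTop :=
  Real.tendsto_sqrt_atTop.comp tendsto_natCast_atTop_atTop

/-- The downward shift gives `G δ y ≤ -slopeG δ / √d`, which outweighs the error `L / d` from `d / N
≠ δ`; rounding `k` down only helps. -/
theorem eventually_G_critical_odd (h1 : 1 / 2 < δ) (h2 : δ < 1) (hρ : 0 < ρ)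
    (hρS : ρ = rhoS δ) :
    ∀ᶠ d : ℕ in atTop, ¬ Even d →
    criticalN δ d * G (d / criticalN δ d) (criticalK ρ d / d) ≤ 0 := by
  have hρ1 : ρ < 1 := hρS ▸ rhoS_lt_one h1 h2
  have hκ := slopeG_pos h1 h2
  have hg := isGrowth_critical (by linarith : 0 < δ) h2 hρ hρ1
  obtain ⟨L, hL, hGL⟩ := eventually_abs_G_critical_sub_le (by linarith : 0 < δ) h2
  filter_upwards [hGL, eventually_criticalK_div hρ hρ1, eventually_ge_atTop 2,
    tendsto_sqrt_natCast_atTop.eventually_ge_atTop (L / slopeG δ)] with d hd hy hd2 hsq hodd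
  have hd' : (0 : ℝ) < d := by
    have : 0 < d := by omega
    exact_mod_cast this
  have hkd : (criticalK ρ d : ℝ) ≤ d := by exact_mod_cast (hg.lt_dim d hd2).le
  set y := (criticalK ρ d : ℝ) / d
  have hy0 : 0 ≤ y := by positivity
  have hy1 : y ≤ 1 := (div_le_one hd').2 hkd
  have hs : 0 < √(d : ℝ) := Real.sqrt_pos.2 hd'
  have hyρ : y ≤ ρ - 1 / √(d : ℝ) := by
    refine hy.2.trans (le_of_eq ?_)
    rw [perturbed, if_neg hodd]
    ring
  have hpos : 0 < 1 / √(d : ℝ) := by positivity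
  have h3 := G_le_of_le_rhoS h1 h2 hy0 (by linarith : y ≤ rhoS δ)
  have h4 : slopeG δ * (1 / √(d : ℝ)) ≤ slopeG δ * (rhoS δ - y) :=
    mul_le_mul_of_nonneg_left (by linarith) hκ.le
  have h5 := (abs_le.1 (hd y ⟨hy0, hy1⟩)).2
  have h6 : L / d ≤ slopeG δ * (1 / √(d : ℝ)) := by
    rw [div_le_iff₀ hκ] at hsq
    rw [div_le_iff₀ hd']
    have : slopeG δ * (1 / √(d : ℝ)) * d = √(d : ℝ) * slopeG δ := by
      field_simp
      rw [Real.sq_sqrt hd'.le]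
    rwa [this]
  exact mul_nonpos_of_nonneg_of_nonpos (Nat.cast_nonneg _) (by linarith)

theorem eventually_G_critical_even (h1 : 1 / 2 < δ) (h2 : δ < 1) (hρ : 0 < ρ)
    (hρS : ρ = rhoS δ) :
    ∀ᶠ d : ℕ in atTop, Even d →
    slopeG δ / 4 * √(d : ℝ) ≤
      criticalN δ d * G (d / criticalN δ d) (criticalK ρ d / d) := by
  have hρ1 : ρ < 1 := hρS ▸ rhoS_lt_one h1 h2
  have hκ := slopeG_pos h1 h2
  have hg := isGrowth_critical (by linarith : 0 < δ) h2 hρ hρ1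
  obtain ⟨L, hL, hGL⟩ := eventually_abs_G_critical_sub_le (by linarith : 0 < δ) h2
  filter_upwards [hGL, eventually_criticalK_div hρ hρ1, eventually_ge_atTop 2,
    tendsto_sqrt_natCast_atTop.eventually_ge_atTop (4 * L / slopeG δ),
    tendsto_sqrt_natCast_atTop.eventually_ge_atTop 2] with d hd hy hd2 hsq hsq2 heven
  have hd' : (0 : ℝ) < d := by
    have : 0 < d := by omega
    exact_mod_cast this
  have hkd : (criticalK ρ d : ℝ) ≤ d := by exact_mod_cast (hg.lt_dim d hd2).le
  have hdN : (d : ℝ) ≤ criticalN δ d := by exact_mod_cast (hg.dim_lt d hd2).le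
  set y := (criticalK ρ d : ℝ) / d
  have hy0 : 0 ≤ y := by positivity
  have hy1 : y ≤ 1 := (div_le_one hd').2 hkd
  set s := √(d : ℝ) with hsdef
  have hs : 0 < s := Real.sqrt_pos.2 hd'
  have hds : (d : ℝ) = s ^ 2 := (Real.sq_sqrt hd'.le).symm
  -- Rounding `k` down costs at most `1 / d`, which is at most half of the shift `1 / √d` once `√d ≥
  -- 2`.
  have hyρ : ρ + 1 / (2 * s) ≤ y := by
    refine le_trans ?_ hy.1
    rw [perturbed, if_pos heven, ← hsdef, hds]
    have : 1 / s - 1 / s ^ 2 - 1 / (2 * s) = (s - 2) / (2 * s ^ 2) := by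
      field_simp
      ring
    have h7 : 0 ≤ (s - 2) / (2 * s ^ 2) := div_nonneg (by linarith) (by positivity)
    linarith
  have hpos : 0 < 1 / (2 * s) := by positivity
  have h3 := le_G_of_rhoS_le h1 h2 (by linarith : rhoS δ ≤ y) hy1
  have h4 : slopeG δ * (1 / (2 * s)) ≤ slopeG δ * (y - rhoS δ) :=
    mul_le_mul_of_nonneg_left (by linarith) hκ.le
  have h5 := (abs_le.1 (hd y ⟨hy0, hy1⟩)).1
  have h6 : L / d ≤ slopeG δ / (4 * s) := by
    rw [div_le_iff₀ hκ] at hsq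
    rw [hds, div_le_div_iff₀ (by positivity) (by positivity)]
    nlinarith
  -- Half of the gain `slopeG δ / (2 * s)` absorbs the error `L / d`.
  have h7 : slopeG δ / (4 * s) ≤ G (d / criticalN δ d) y := by
    have : slopeG δ * (1 / (2 * s)) = slopeG δ / (4 * s) + slopeG δ / (4 * s) := by
      field_simp
      ring
    linarith
  calc slopeG δ / 4 * s = d * (slopeG δ / (4 * s)) := by
        rw [hds]
        field_simp
    _ ≤ _ := by gcongr

theorem liminf_expectedDefect_critical (h1 : 1 / 2 < δ) (h2 : δ < 1) (hρ : 0 < ρ)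
    (hρS : ρ = rhoS δ) (hρW : ρ < rhoW δ) :
    liminf (fun d => ((expectedDefect (criticalN δ d) d (criticalK ρ d) : ℝ) : EReal)) atTop = 0 := by
  have hρ1 : ρ < 1 := hρS ▸ rhoS_lt_one h1 h2
  have hg := isGrowth_critical (by linarith : 0 < δ) h2 hρ hρ1
  obtain ⟨C, hC⟩ := hg.expectedDefect_le h1 h2 hρ hρW
  have hodd : Tendsto (fun n : ℕ => 2 * n + 1) atTop atTop :=
    tendsto_atTop_mono (fun n => by simp only [id]; omega) tendsto_id
  refine le_antisymm ?_ ?_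
  · have hlim : Tendsto (fun n : ℕ =>
        expectedDefect (criticalN δ (2 * n + 1)) (2 * n + 1) (criticalK ρ (2 * n + 1)))
        atTop (𝓝 0) := by
      refine squeeze_zero' ?_ ?_ ((tendsto_const_div_atTop_nhds_zero_nat C).comp hodd)
      · filter_upwards [hodd.eventually_ge_atTop 2] with n hn
        exact (hg.expectedDefect_pos hn).le
      · filter_upwards [hodd.eventually hC,
          hodd.eventually (eventually_G_critical_odd h1 h2 hρ hρS)] with n hn hn2
        exact hn (hn2 (by simp))
    -- The limit along odd dimensions bounds the lower limit from above; positivity of the defect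
    -- gives the other inequality.
    refine le_trans (liminf_le_liminf_of_le hodd) (le_of_eq ?_)
    rw [← liminf_comp]
    exact ((continuous_coe_real_ereal.tendsto 0).comp hlim).liminf_eq
  · refine le_liminf_of_le (by isBoundedDefault) ?_
    filter_upwards [eventually_ge_atTop 2] with d hd
    exact_mod_cast (hg.expectedDefect_pos hd).le

theorem limsup_expectedDefect_critical (h1 : 1 / 2 < δ) (h2 : δ < 1) (hρ : 0 < ρ)
    (hρS : ρ = rhoS δ) (hρW : ρ < rhoW δ) :
    limsup (fun d => ((expectedDefect (criticalN δ d) d (criticalK ρ d) : ℝ) : EReal)) atTop = ⊤ := by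
  have hρ1 : ρ < 1 := hρS ▸ rhoS_lt_one h1 h2
  have hg := isGrowth_critical (by linarith : 0 < δ) h2 hρ hρ1
  obtain ⟨C, hC0, hC⟩ := hg.le_expectedDefect h1 h2 hρ hρW
    (by linarith [slopeG_pos h1 h2] : 0 < slopeG δ / 4)
  have heven : Tendsto (fun n : ℕ => 2 * n) atTop atTop :=
    tendsto_atTop_mono (fun n => by simp only [id]; omega) tendsto_id
  have hlim : Tendsto (fun n : ℕ =>
      expectedDefect (criticalN δ (2 * n)) (2 * n) (criticalK ρ (2 * n))) atTop atTop := by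
    refine tendsto_atTop_mono' _ ?_
      ((tendsto_natCast_atTop_atTop.const_mul_atTop hC0).comp heven)
    filter_upwards [heven.eventually hC,
      heven.eventually (eventually_G_critical_even h1 h2 hρ hρS)] with n hn hn2
    exact hn (hn2 (by simp))
  refine top_le_iff.1 (le_trans (le_of_eq ?_) (limsup_le_limsup_of_le heven))
  rw [← limsup_comp]
  exact (EReal.tendsto_coe_nhds_top_iff.2 hlim).limsup_eq.symm

end Critical

end DonohoTanner

end

/-! ### Transfer from the expected defect to random cones -/

theorem theoremT6p1 (δ ρ : ℝ) (hδ : 1 / 2 < δ) (hδ' : δ < 1) (hρ : 0 < ρ)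
    (hρ' : ρ < DonohoTanner.rhoW δ) :
    (∀ (d₀ : ℕ) (N k : ℕ → ℕ), DonohoTanner.IsGrowth δ ρ d₀ N k →
      ∀ (Ω : ℕ → Type*) [∀ d, MeasurableSpace (Ω d)] (P : ∀ d, Measure (Ω d))
        (φ : ∀ d, Measure (DonohoTanner.E d)) (X : ∀ d, Fin (N d) → Ω d → DonohoTanner.E d),
        (∀ d ≥ d₀, DonohoTanner.IsSample (P d) (φ d) (X d)) →
        (∀ d ≥ d₀, Integrable (DonohoTanner.faceCount (k d) (X d)) (P d)) ∧
        (∃ (g : ℕ → ℝ) (a b : ℝ), 0 < a ∧ 0 < b ∧ ∀ d ≥ d₀, g d ∈ Set.Icc a b ∧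
          DonohoTanner.faceDefect (P d) (k d) (X d) =
            1 / (N d : ℝ) *
              Real.exp (N d * DonohoTanner.G ((d : ℝ) / (N d : ℝ)) ((k d : ℝ) / (d : ℝ))) *
              g d) ∧
        (ρ < DonohoTanner.rhoS δ →
          Tendsto (fun d => DonohoTanner.faceDefect (P d) (k d) (X d)) atTop (𝓝 0)) ∧
        (DonohoTanner.rhoS δ < ρ →
          Tendsto (fun d => DonohoTanner.faceDefect (P d) (k d) (X d)) atTop atTop)) ∧
    (ρ = DonohoTanner.rhoS δ →
      ∃ N k : ℕ → ℕ, DonohoTanner.IsGrowth δ ρ 2 N k ∧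
        ∀ (Ω : ℕ → Type*) [∀ d, MeasurableSpace (Ω d)] (P : ∀ d, Measure (Ω d))
          (φ : ∀ d, Measure (DonohoTanner.E d)) (X : ∀ d, Fin (N d) → Ω d → DonohoTanner.E d),
          (∀ d ≥ 2, DonohoTanner.IsSample (P d) (φ d) (X d)) →
          liminf (fun d => ((DonohoTanner.faceDefect (P d) (k d) (X d) : ℝ) : EReal)) atTop = 0 ∧
          limsup (fun d => ((DonohoTanner.faceDefect (P d) (k d) (X d) : ℝ) : EReal)) atTop = ⊤)
    := by
  refine ⟨fun d₀ N k h Ω _ P φ X hX => ?_, fun hρS => ?_⟩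
  · have hN : ∀ d ≥ d₀, 0 < N d := fun d hd => by have := h.dim_lt d hd; omega
    have hdef : ∀ d ≥ d₀, DonohoTanner.faceDefect (P d) (k d) (X d) =
        DonohoTanner.expectedDefect (N d) d (k d) := fun d hd =>
      (hX d hd).faceDefect_eq (hN d hd) (h.lt_dim d hd)
    have hev : (fun d => DonohoTanner.expectedDefect (N d) d (k d)) =ᶠ[atTop]
        fun d => DonohoTanner.faceDefect (P d) (k d) (X d) := by
      filter_upwards [eventually_ge_atTop d₀] with d hd
      exact (hdef d hd).symm
    refine ⟨fun d hd => (hX d hd).integrable_faceCount (hN d hd) (h.lt_dim d hd), ?_,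
      fun hρS => (h.tendsto_expectedDefect_zero hδ hδ' hρ hρ' hρS).congr' hev,
      fun hρS => (h.tendsto_expectedDefect_atTop hδ hδ' hρ hρ' hρS).congr' hev⟩
    obtain ⟨a, b, ha, hb, hab⟩ := h.exists_bounds hδ hδ' hρ hρ'
    refine ⟨fun d => DonohoTanner.normalizedDefect (N d) d (k d), a, b, ha, hb,
      fun d hd => ⟨hab d hd, ?_⟩⟩
    rw [hdef d hd]
    exact DonohoTanner.expectedDefect_eq_normalizedDefect (hN d hd)
  · have hρ1 : ρ < 1 := hρS ▸ DonohoTanner.rhoS_lt_one hδ hδ'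
    have h := DonohoTanner.isGrowth_critical (by linarith : 0 < δ) hδ' hρ hρ1
    refine ⟨_, _, h, fun Ω _ P φ X hX => ?_⟩
    have hev : (fun d => ((DonohoTanner.faceDefect (P d) (DonohoTanner.criticalK ρ d) (X d) : ℝ) :
        EReal)) =ᶠ[atTop] fun d => ((DonohoTanner.expectedDefect (DonohoTanner.criticalN δ d) d
          (DonohoTanner.criticalK ρ d) : ℝ) : EReal) := by
      filter_upwards [eventually_ge_atTop 2] with d hd
      rw [(hX d hd).faceDefect_eq (by have := h.dim_lt d hd; omega) (h.lt_dim d hd)]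
    rw [liminf_congr hev, limsup_congr hev]
    exact ⟨DonohoTanner.liminf_expectedDefect_critical hδ hδ' hρ hρS hρ',
      DonohoTanner.limsup_expectedDefect_critical hδ hδ' hρ hρS hρ'⟩
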